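/- Let $R=\bigoplus_{i\ge 0}R_i$ be an $\mathbb{N}$-graded integral domain that is finitely generated as an algebra over $R_0$, where $R_0$ is a field of prime characteristic. Set $\mathfrak{m}=\bigoplus_{i>0}R_i$ and $d=\dim R$, and assume $d\ge 1$. Let $R^{+\mathrm{GR}}$ be the $R$-subalgebra of an algebraic closure of $\operatorname{frac}(R)$ generated by all elements $z$ to which one can assign a degree $q\in\mathbb{Q}_{\ge 0}$ such that $z$ satisfies a homogeneous equation of integral dependence over $R$, i.e. $z^N+r_1z^{N-1}+\cdots+r_N=0$ with each $r_i\in R$ either zero or homogeneous of degree $iq$. Give $H^d_{\mathfrak m}(R)$ the $\mathbb{Z}$-grading induced by the Čech complex on homogeneous elements generating $\mathfrak{m}$ up to radical, and let $[H^d_{\mathfrak m}(R)]_{\ge 0}$ be the submodule $\bigoplus_{n\ge 0}[H^d_{\mathfrak m}(R)]_n$. Then $[H^d_{\mathfrak m}(R)]_{\ge 0}$ maps to zero under the induced map $$H^d_{\mathfrak m}(R)\longrightarrow H^d_{\mathfrak m}(R^{+\mathrm{GR}}).$$ Moreover, there exists an integral domain $S$ containing $R$ that is finitely generated as an $R$-module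 and carries a $\mathbb{Q}$-grading extending the grading of $R$ (that is, $R_i\subseteq S_i$ for all $i$), such that the induced map $[H^d_{\mathfrak m}(R)]_{\ge 0}\longrightarrow H^d_{\mathfrak m}(S)$ is zero. -/

import Mathlib

open Polynomial

universe u v w w'

namespace GradedLC

/-! ### The Čech complex of a module on a finite family of ring elements -/

section Cech

variable {R : Type u} [CommRing R]

/-- `M[1/a]`. -/
abbrev Loc (a : R) (M : Type w) [AddCommGroup M] [Module R M] : Type (max u w) :=
  LocalizedModule (Submonoid.powers a) M

theorem isUnit_of_dvd {a b : R} (h : a ∣ b) (M : Type w) [AddCommGroup M] [Module R M]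
    (s : Submonoid.powers a) :
    IsUnit (algebraMap R (Module.End R (Loc b M)) s) := by
  obtain ⟨s, n, rfl⟩ := s
  obtain ⟨c, rfl⟩ := h
  have hb := IsLocalizedModule.map_units
    (LocalizedModule.mkLinearMap (Submonoid.powers (a * c)) M)
    (⟨(a * c) ^ n, n, rfl⟩ : Submonoid.powers (a * c))
  simp only [mul_pow, map_mul] at hb ⊢
  have hc : Commute (algebraMap R (Module.End R (Loc (a * c) M)) a ^ n)
      (algebraMap R (Module.End R (Loc (a * c) M)) c ^ n) := by
    rw [← map_pow, ← map_pow]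
    exact Algebra.commutes _ _
  simp only [map_pow] at hb ⊢
  exact (hc.isUnit_mul_iff.1 hb).1

/-- The canonical map `M[1/a] → M[1/b]` for `a ∣ b`. -/
noncomputable def locRes {a b : R} (h : a ∣ b) (M : Type w) [AddCommGroup M] [Module R M] :
    Loc a M →ₗ[R] Loc b M :=
  LocalizedModule.lift (Submonoid.powers a)
    (LocalizedModule.mkLinearMap (Submonoid.powers b) M) (isUnit_of_dvd h M)

/-- The map `M[1/a] → N[1/a]` induced by `f : M → N`. -/
noncomputable def locMap (a : R) {M : Type w} {N : Type w'} [AddCommGroup M] [Module R M]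
    [AddCommGroup N] [Module R N] (f : M →ₗ[R] N) : Loc a M →ₗ[R] Loc a N :=
  IsLocalizedModule.map (Submonoid.powers a)
    (LocalizedModule.mkLinearMap (Submonoid.powers a) M)
    (LocalizedModule.mkLinearMap (Submonoid.powers a) N) f

theorem locRes_mk {a b : R} (h : a ∣ b) (M : Type w) [AddCommGroup M] [Module R M] (m : M) :
    locRes h M (LocalizedModule.mkLinearMap (Submonoid.powers a) M m) =
      LocalizedModule.mkLinearMap (Submonoid.powers b) M m :=
  LinearMap.congr_fun (LocalizedModule.lift_comp (Submonoid.powers a)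
    (LocalizedModule.mkLinearMap (Submonoid.powers b) M) (isUnit_of_dvd h M)) m

theorem locMap_locRes {a b : R} (h : a ∣ b) {M : Type w} {N : Type w'} [AddCommGroup M]
    [Module R M] [AddCommGroup N] [Module R N] (f : M →ₗ[R] N) (z : Loc a M) :
    locMap b f (locRes h M z) = locRes h N (locMap a f z) := by
  have key : (locMap b f).comp (locRes h M) = (locRes h N).comp (locMap a f) := by
    apply IsLocalizedModule.ext (Submonoid.powers a)
      (LocalizedModule.mkLinearMap (Submonoid.powers a) M) (isUnit_of_dvd h N)
    ext m
    have h2 : ∀ (c : R), locMap c f (LocalizedModule.mkLinearMap (Submonoid.powers c) M m) =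
          LocalizedModule.mkLinearMap (Submonoid.powers c) N (f m) := fun c =>
      IsLocalizedModule.map_apply _ _ _ _ _
    simp only [LinearMap.comp_apply]
    rw [locRes_mk, h2, h2, locRes_mk]
  exact LinearMap.congr_fun key z

variable {n : ℕ} (x : Fin n → R)

/-- The product `x_{i_1} ⋯ x_{i_k}` attached to `i_1 < ⋯ < i_k`. -/
def prodAt {k : ℕ} (σ : Fin k ↪o Fin n) : R := ∏ j, x (σ j)

/-- The increasing sequence `σ` with its `j`-th entry left out. -/
def face {k : ℕ} (σ : Fin (k + 1) ↪o Fin n) (j : Fin (k + 1)) : Fin k ↪o Fin n :=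
  (Fin.succAboveOrderEmb j).trans σ

theorem prodAt_face_dvd {k : ℕ} (σ : Fin (k + 1) ↪o Fin n) (j : Fin (k + 1)) :
    prodAt x (face σ j) ∣ prodAt x σ := by
  unfold prodAt
  rw [Fin.prod_univ_succAbove _ j]
  exact Dvd.intro_left _ rfl

/-- The term `C^k(x; M) = ⨁_{i_1 < ⋯ < i_k} M[1 / (x_{i_1} ⋯ x_{i_k})]` of the Čech complex
`0 → M → ⨁ M[1/x_i] → ⋯ → M[1/(x_1 ⋯ x_n)] → 0`. -/
abbrev Cochain (M : Type w) [AddCommGroup M] [Module R M] (k : ℕ) : Type (max u w) :=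
  ∀ σ : Fin k ↪o Fin n, Loc (prodAt x σ) M

/-- The Čech differential, an alternating sum of canonical maps. -/
noncomputable def diff (M : Type w) [AddCommGroup M] [Module R M] (k : ℕ) :
    Cochain x M k →ₗ[R] Cochain x M (k + 1) :=
  LinearMap.pi fun σ => ∑ j : Fin (k + 1), (-1 : R) ^ (j : ℕ) •
    (locRes (prodAt_face_dvd x σ j) M).comp (LinearMap.proj (face σ j))

/-- Čech cocycles. -/
noncomputable def cocycles (M : Type w) [AddCommGroup M] [Module R M] (k : ℕ) :
    Submodule R (Cochain x M k) := LinearMap.ker (diff x M k)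

/-- Čech coboundaries. -/
noncomputable def coboundaries (M : Type w) [AddCommGroup M] [Module R M] :
    (k : ℕ) → Submodule R (Cochain x M k)
  | 0 => ⊥
  | k + 1 => LinearMap.range (diff x M k)

/-- The `k`-th cohomology of the Čech complex: the local cohomology module
`H^k_𝔞(M)`, where `𝔞` is the radical of the ideal generated by the `x_i`. -/
abbrev LocalCoh (M : Type w) [AddCommGroup M] [Module R M] (k : ℕ) : Type (max u w) :=
  cocycles x M k ⧸ (coboundaries x M k).submoduleOf (cocycles x M k)

section Functoriality

variable {M : Type w} {N : Type w'} [AddCommGroup M] [Module R M] [AddCommGroup N] [Module R N]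
  (f : M →ₗ[R] N)

/-- The map of Čech cochains induced by a linear map. -/
noncomputable def cochainMap (k : ℕ) : Cochain x M k →ₗ[R] Cochain x N k :=
  LinearMap.pi fun σ => (locMap (prodAt x σ) f).comp (LinearMap.proj σ)

theorem cochainMap_diff (k : ℕ) (c : Cochain x M k) :
    cochainMap x f (k + 1) (diff x M k c) = diff x N k (cochainMap x f k c) := by
  ext σ
  simp [cochainMap, diff, locMap_locRes]

theorem cochainMap_cocycles (k : ℕ) :
    ∀ c ∈ cocycles x M k, cochainMap x f k c ∈ cocycles x N k := by
  intro c hc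
  simp only [cocycles, LinearMap.mem_ker] at hc ⊢
  rw [← cochainMap_diff, hc, map_zero]

theorem cochainMap_coboundaries (k : ℕ) :
    ∀ b ∈ coboundaries x M k, cochainMap x f k b ∈ coboundaries x N k := by
  cases k with
  | zero =>
    intro c hc
    have hc0 : c = 0 := hc
    rw [hc0, map_zero]
    exact zero_mem _
  | succ k =>
    rintro _ ⟨b, rfl⟩
    exact ⟨cochainMap x f k b, (cochainMap_diff x f k b).symm⟩

/-- The map `H^k_𝔞(M) → H^k_𝔞(N)` induced by a linear map `M → N`. -/
noncomputable def localCohMap (k : ℕ) : LocalCoh x M k →ₗ[R] LocalCoh x N k :=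
  Submodule.mapQ _ _ ((cochainMap x f k).restrict (cochainMap_cocycles x f k))
    fun _ hc => cochainMap_coboundaries x f k _ hc

end Functoriality

end Cech

/-! ### The grading on the local cohomology of a graded ring -/

section Grading

variable {K : Type v} {R : Type u} [Field K] [CommRing R] [Algebra K R] (𝒜 : ℕ → Submodule K R)

/-- The degree `m` part of `R[1/a]` (where `a` is homogeneous): the group of fractions `r / s`
with `s` a power of `a`, `r` and `s` homogeneous and `deg r - deg s = m`. -/
def locDegree (a : R) (m : ℤ) : AddSubgroup (Loc a R) :=
  AddSubgroup.closure {z | ∃ (i j : ℕ) (r : R) (s : Submonoid.powers a),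
    r ∈ 𝒜 i ∧ (s : R) ∈ 𝒜 j ∧ (i : ℤ) - j = m ∧ z = LocalizedModule.mk r s}

variable {n : ℕ} (x : Fin n → R)

/-- The degree `m` part `[H^k_𝔞(R)]_m`: the classes of those cocycles all of whose components
are homogeneous of degree `m`. -/
noncomputable def localCohDegree (k : ℕ) (m : ℤ) : AddSubgroup (LocalCoh x R k) :=
  ((AddSubgroup.pi Set.univ fun σ : Fin k ↪o Fin n => locDegree 𝒜 (prodAt x σ) m).comap
      (cocycles x R k).subtype.toAddMonoidHom).map
    ((coboundaries x R k).submoduleOf (cocycles x R k)).mkQ.toAddMonoidHom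

/-- The submodule `[H^k_𝔞(R)]_{≥ 0}` generated by the components of nonnegative degree. -/
noncomputable def localCohNonneg (k : ℕ) : Submodule R (LocalCoh x R k) :=
  Submodule.span R (⋃ m : ℕ, (localCohDegree 𝒜 x k (m : ℤ) : Set (LocalCoh x R k)))

/-- `x` is a finite family of homogeneous elements which generates the homogeneous maximal ideal
`𝔪 = ⨁_{i > 0} R_i` up to radical, so that its Čech complex computes `H^•_𝔪`. -/
def Supports [GradedAlgebra 𝒜] : Prop :=
  (∀ i, SetLike.IsHomogeneousElem 𝒜 (x i)) ∧
    (Ideal.span (Set.range x)).radical = (HomogeneousIdeal.irrelevant 𝒜).toIdeal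

end Grading

/-! ### The ring `R^{+GR}` -/

section PlusGR

variable {K : Type v} {R : Type u} [Field K] [CommRing R] [IsDomain R] [Algebra K R]
  (𝒜 : ℕ → Submodule K R)

/-- The element `z` of the algebraic closure of `frac R` can be assigned degree `q`: it satisfies
an equation of integral dependence `z^N + r_1 z^{N-1} + ⋯ + r_N = 0` over `R` that is homogeneous
when `z` is given degree `q`, i.e. each `r_i` is `0` or homogeneous of degree `i q`. -/
def HasDegree (q : ℚ) (z : AlgebraicClosure (FractionRing R)) : Prop :=
  ∃ P : R[X], P.Monic ∧ aeval z P = 0 ∧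
    ∀ i ≤ P.natDegree, P.coeff (P.natDegree - i) = 0 ∨
      ∃ e : ℕ, (e : ℚ) = i * q ∧ P.coeff (P.natDegree - i) ∈ 𝒜 e

/-- `R^{+GR}`, the `R`-algebra generated inside the algebraic closure of `frac R` by the integral
elements that can be assigned a degree in `ℚ_{≥ 0}`. -/
noncomputable def PlusGR : Subalgebra R (AlgebraicClosure (FractionRing R)) :=
  Algebra.adjoin R {z | ∃ q : ℚ, 0 ≤ q ∧ HasDegree 𝒜 q z}

end PlusGR

end GradedLC

/-! Let t be a homogeneous system of parameters (`exists_homogeneous_parameters`). Then H^d_𝔪(R) is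
R[1/∏ t_j] modulo the sum of the R[1/∏_{j≠i} t_j], the submodule `faceSum`. As R is spanned over K
by monomials in t times finitely many homogeneous elements g, the nonnegative degrees of this
quotient are spanned by finitely many fractions g/∏ t_i^(b_i+1), of bounded degree
(`exists_finset_span`). Frobenius multiplies degrees by p. So a class α of positive degree is killed
by a power of Frobenius, while for α of degree 0 the iterates α^(p^n) are linearly dependent over K.
In both cases an additive polynomial Φ(y) = y^(p^e) + ∑ c_i y^(p^i) maps α into `faceSum`, say Φ(α)
= ∑ β_i (`exists_frobPoly_mem_faceSum`).

The equational lemma (`exists_finset_mem_faceSum`) solves Φ(y_i) = β_i with y_i homogeneous of the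
degree of α. By additivity γ = α - ∑ y_i is a root of Φ, hence integral over R; and y_i becomes
integral after multiplication by a power of ∏_{j≠i} t_j. Over any ring containing these integral
elements, α = γ + ∑ y_i lies in the face sum. Finitely many classes α have to be treated, so
finitely many homogeneous integral elements suffice; they generate S.

The equations are solved in the group algebra Ω[ℚ] = ⨁ Ω u^q, with Ω the algebraic closure of frac R
and r ∈ R_i sent to r u^i (`Host.isHost`). It is a ℚ-graded domain in which nonzero homogeneous
elements of R are units, so the localizations of R and of S that occur are submodules of one ring
(`locIn`) and Čech cochains are functions on finite sets with values in it. Setting u = 1 maps S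
into R^{+GR} (`Host.hasDegree_eval`), so the first assertion follows from the one about S.

An arbitrary family x supporting 𝔪 is compared with t through the joint family: cocycles extend, and
primitives extend, along added vertices whose elements lie in the radical of the ideal already
generated (`exists_cocycle_union`, `exists_codiff_eq_union`). -/

namespace GradedLC

/-! ### Alternating cochains on the finite subsets of a linearly ordered set -/

section FinsetCochain

variable {ι : Type*} [LinearOrder ι]

/-- The sign with which the `i`-th face of `s` enters the differential. -/
def faceSign (s : Finset ι) (i : ι) : ℤ := (-1) ^ (s.filter (· < i)).card

theorem faceSign_mul_self (s : Finset ι) (i : ι) : faceSign s i * faceSign s i = 1 := by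
  unfold faceSign
  rw [← mul_pow]
  simp

theorem faceSign_erase_of_lt {s : Finset ι} {i j : ι} (hi : i ∈ s) (hij : i < j) :
    faceSign (s.erase i) j = -faceSign s j ∧ faceSign (s.erase j) i = faceSign s i := by
  constructor
  · unfold faceSign
    have h1 : (s.erase i).filter (· < j) = (s.filter (· < j)).erase i := by
      ext a; simp only [Finset.mem_filter, Finset.mem_erase]; tauto
    have h2 : i ∈ s.filter (· < j) := by simp [hi, hij]
    rw [h1, ← Finset.card_erase_add_one h2, pow_succ]
    ring
  · unfold faceSign
    congr 2
    ext a
    simp only [Finset.mem_filter, Finset.mem_erase]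
    constructor
    · tauto
    · rintro ⟨h1, h2⟩
      exact ⟨⟨(h2.trans hij).ne, h1⟩, h2⟩

theorem faceSign_mul_erase {s : Finset ι} {i j : ι} (hi : i ∈ s) (hj : j ∈ s) (hij : i ≠ j) :
    faceSign s i * faceSign (s.erase i) j = -(faceSign s j * faceSign (s.erase j) i) := by
  rcases lt_or_gt_of_ne hij with h | h
  · obtain ⟨h1, h2⟩ := faceSign_erase_of_lt hi h
    rw [h1, h2]; ring
  · obtain ⟨h1, h2⟩ := faceSign_erase_of_lt hj h
    rw [h1, h2]; ring

variable {T : Type*} [AddCommGroup T]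

/-- The simplicial differential on functions of finite subsets. -/
def codiff (c : Finset ι → T) (s : Finset ι) : T :=
  ∑ i ∈ s, faceSign s i • c (s.erase i)

theorem codiff_congr {c c' : Finset ι → T} {s : Finset ι} (h : ∀ t ⊆ s, c t = c' t) :
    codiff c s = codiff c' s :=
  Finset.sum_congr rfl fun i _ => by rw [h _ (Finset.erase_subset i s)]

theorem codiff_add (b c : Finset ι → T) (s : Finset ι) :
    codiff (b + c) s = codiff b s + codiff c s := by
  simp [codiff, Finset.sum_add_distrib]

theorem codiff_sub (b c : Finset ι → T) (s : Finset ι) :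
    codiff (b - c) s = codiff b s - codiff c s := by
  simp [codiff, smul_sub, Finset.sum_sub_distrib]

theorem codiff_map {T' : Type*} [AddCommGroup T'] (f : T →+ T') (c : Finset ι → T)
    (s : Finset ι) : codiff (fun t => f (c t)) s = f (codiff c s) := by
  simp [codiff, map_sum, map_zsmul]

/-- Deleting i then j and deleting j then i give the same set with opposite signs, so swapping the
pair is a sign-reversing involution on the double sum. -/
theorem codiff_codiff (c : Finset ι → T) (s : Finset ι) : codiff (codiff c) s = 0 := by
  have h1 : codiff (codiff c) s = ∑ a ∈ s.offDiag,
      (faceSign s a.1 * faceSign (s.erase a.1) a.2) • c ((s.erase a.1).erase a.2) := by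
    unfold codiff
    have h2 : s.offDiag = (s ×ˢ s).filter fun a => a.1 ≠ a.2 := by
      ext a; simp [Finset.mem_offDiag, and_assoc]
    rw [h2, Finset.sum_filter, Finset.sum_product]
    refine Finset.sum_congr rfl fun i _ => ?_
    rw [Finset.smul_sum, ← Finset.sum_filter]
    have h3 : s.filter (fun j => i ≠ j) = s.erase i := by
      ext a; simp only [Finset.mem_filter, Finset.mem_erase]; tauto
    rw [h3]
    exact Finset.sum_congr rfl fun j _ => by rw [mul_smul]
  rw [h1]
  refine Finset.sum_involution (fun a _ => a.swap) ?_ ?_ ?_ ?_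
  · rintro ⟨i, j⟩ ha
    obtain ⟨hi, hj, hij⟩ := Finset.mem_offDiag.1 ha
    simp only [Prod.fst_swap, Prod.snd_swap] at *
    rw [faceSign_mul_erase hi hj hij, Finset.erase_right_comm, neg_smul, neg_add_cancel]
  · rintro ⟨i, j⟩ ha _ h
    obtain ⟨hi, hj, hij⟩ := Finset.mem_offDiag.1 ha
    simp only [Prod.swap_prod_mk, Prod.mk.injEq] at h
    exact hij h.2
  · rintro ⟨i, j⟩ ha
    obtain ⟨hi, hj, hij⟩ := Finset.mem_offDiag.1 ha
    exact Finset.mem_offDiag.2 ⟨hj, hi, fun h => hij h.symm⟩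
  · rintro ⟨i, j⟩ _
    rfl

/-- The cone operator with vertex `i`. -/
def cone (i : ι) (c : Finset ι → T) (s : Finset ι) : T :=
  if i ∈ s then 0 else faceSign (insert i s) i • c (insert i s)

theorem cone_of_mem {i : ι} {s : Finset ι} (h : i ∈ s) (c : Finset ι → T) : cone i c s = 0 :=
  if_pos h

theorem cone_of_notMem {i : ι} {s : Finset ι} (h : i ∉ s) (c : Finset ι → T) :
    cone i c s = faceSign (insert i s) i • c (insert i s) := if_neg h

/-- The cone is a contracting homotopy, so with all values in the single group T every cocycle has a
primitive. The only obstruction is one of denominators: the value of the cone at s comes from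
`insert i s`, and may involve the inverse of the element at i. -/
theorem codiff_cone_add (i : ι) (c : Finset ι → T) (s : Finset ι) :
    codiff (cone i c) s + cone i (codiff c) s = c s := by
  by_cases hi : i ∈ s
  · rw [cone_of_mem hi, add_zero, codiff, Finset.sum_eq_single_of_mem i hi]
    · rw [cone_of_notMem (Finset.notMem_erase i s), Finset.insert_erase hi, smul_smul,
        faceSign_mul_self, one_smul]
    · intro j _ hji
      rw [cone_of_mem (Finset.mem_erase.2 ⟨hji.symm, hi⟩), smul_zero]
  · rw [cone_of_notMem hi, codiff, codiff, Finset.sum_insert hi, smul_add, smul_smul,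
      faceSign_mul_self, one_smul, Finset.erase_insert hi, Finset.smul_sum, add_left_comm,
      ← Finset.sum_add_distrib, Finset.sum_eq_zero, add_zero]
    intro j hj
    have hij : i ≠ j := fun h => hi (h ▸ hj)
    have h1 : (insert i s).erase j = insert i (s.erase j) :=
      Finset.erase_insert_of_ne hij
    have h2 := faceSign_mul_erase (Finset.mem_insert_self i s) (Finset.mem_insert_of_mem hj) hij
    rw [Finset.erase_insert hi, h1] at h2
    rw [cone_of_notMem (fun h => hi (Finset.mem_of_mem_erase h)), smul_smul, smul_smul, h1,
      ← add_smul]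
    have h3 : faceSign s j * faceSign (insert i (s.erase j)) i +
        faceSign (insert i s) i * faceSign (insert i s) j = 0 := by
      have ha := faceSign_mul_self (insert i s) i
      have hb := faceSign_mul_self (insert i (s.erase j)) i
      generalize faceSign s j = A at *
      generalize faceSign (insert i (s.erase j)) i = B at *
      generalize faceSign (insert i s) i = C at *
      generalize faceSign (insert i s) j = D at *
      linear_combination C * B * h2 - A * B * ha - C * D * hb
    rw [h3, zero_smul]

/-- Extension by zero to the subsets containing `j`. -/
def dropVertex (j : ι) (c : Finset ι → T) (s : Finset ι) : T := if j ∈ s then 0 else c s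

theorem dropVertex_of_notMem {j : ι} {s : Finset ι} (h : j ∉ s) (c : Finset ι → T) :
    dropVertex j c s = c s := if_neg h

theorem codiff_dropVertex_of_notMem {j : ι} {s : Finset ι} (h : j ∉ s) (c : Finset ι → T) :
    codiff (dropVertex j c) s = codiff c s :=
  codiff_congr fun _ ht => dropVertex_of_notMem (fun hj => h (ht hj)) c

theorem codiff_dropVertex_of_mem {j : ι} {s : Finset ι} (h : j ∈ s) (c : Finset ι → T) :
    codiff (dropVertex j c) s = faceSign s j • c (s.erase j) := by
  rw [codiff, Finset.sum_eq_single_of_mem j h,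
    dropVertex_of_notMem (Finset.notMem_erase j s)]
  intro i _ hij
  rw [dropVertex, if_pos (Finset.mem_erase.2 ⟨hij.symm, h⟩), smul_zero]

end FinsetCochain

/-! ### Adding vertices to a Čech complex does not change its cohomology -/

section Comparison

set_option linter.unusedSectionVars false

variable {ι : Type*} [LinearOrder ι] {R : Type*} [CommRing R] {T : Type*} [CommRing T]
  [Algebra R T]

/-- The localization of `M` at `∏ i ∈ s, z i`, inside an algebra in which this is a unit. -/
def locIn (M : Submodule R T) (z : ι → R) (s : Finset ι) : Submodule R T where
  carrier := {w | ∃ N : ℕ, (∏ i ∈ s, z i) ^ N • w ∈ M}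
  zero_mem' := ⟨0, by simp⟩
  add_mem' := by
    rintro a b ⟨N, hN⟩ ⟨N', hN'⟩
    refine ⟨N + N', ?_⟩
    rw [smul_add]
    refine M.add_mem ?_ ?_
    · rw [pow_add, mul_comm, mul_smul]; exact M.smul_mem _ hN
    · rw [pow_add, mul_smul]; exact M.smul_mem _ hN'
  smul_mem' := by
    rintro r a ⟨N, hN⟩
    refine ⟨N, ?_⟩
    rw [smul_comm]
    exact M.smul_mem _ hN

variable {M : Submodule R T} {z : ι → R}

theorem mem_locIn {s : Finset ι} {w : T} :
    w ∈ locIn M z s ↔ ∃ N : ℕ, (∏ i ∈ s, z i) ^ N • w ∈ M := Iff.rfl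

theorem locIn_mono {M' : Submodule R T} (h : M ≤ M') (s : Finset ι) :
    locIn M z s ≤ locIn M' z s := fun _ ⟨N, hN⟩ => ⟨N, h hN⟩

theorem locIn_subset {s t : Finset ι} (h : s ⊆ t) : locIn M z s ≤ locIn M z t := by
  rintro w ⟨N, hN⟩
  refine ⟨N, ?_⟩
  rw [← Finset.prod_sdiff h, mul_pow, mul_smul]
  exact M.smul_mem _ hN

theorem le_locIn (s : Finset ι) : M ≤ locIn M z s := fun w hw => ⟨0, by simpa using hw⟩

/-- A large power of `z i` clears the denominators at i. Allowing every larger exponent lets one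
exponent serve finitely many sets s at once. -/
theorem exists_pow_smul_mem_locIn {s : Finset ι} {i : ι} {w : T}
    (h : w ∈ locIn M z (insert i s)) : ∃ N : ℕ, ∀ N' ≥ N, z i ^ N' • w ∈ locIn M z s := by
  by_cases hi : i ∈ s
  · rw [Finset.insert_eq_of_mem hi] at h
    exact ⟨0, fun N' _ => Submodule.smul_mem _ _ h⟩
  obtain ⟨N, hN⟩ := h
  refine ⟨N, fun N' hN' => ⟨N, ?_⟩⟩
  rw [Finset.prod_insert hi, mul_pow] at hN
  obtain ⟨k, rfl⟩ := Nat.exists_eq_add_of_le hN'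
  have : (∏ i ∈ s, z i) ^ N • z i ^ (N + k) • w = z i ^ k • (z i ^ N * (∏ i ∈ s, z i) ^ N) • w := by
    rw [smul_smul, smul_smul]; congr 1; ring
  rw [this]
  exact M.smul_mem _ hN

theorem mem_locIn_of_pow_smul {s : Finset ι} {i : ι} (hi : i ∈ s) {w : T} {L : ℕ}
    (h : z i ^ L • w ∈ locIn M z s) : w ∈ locIn M z s := by
  obtain ⟨N, hN⟩ := h
  refine ⟨N + L, ?_⟩
  have : (∏ i ∈ s, z i) ^ (N + L) • w =
      (∏ i ∈ s.erase i, z i) ^ L • (∏ i ∈ s, z i) ^ N • z i ^ L • w := by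
    rw [smul_smul, smul_smul]
    congr 1
    rw [pow_add, ← Finset.mul_prod_erase s z hi]
    ring
  rw [this]
  exact M.smul_mem _ hN

theorem zsmul_mem_locIn {s : Finset ι} {w : T} (h : w ∈ locIn M z s) (e : ℤ) :
    e • w ∈ locIn M z s := (locIn M z s).toAddSubgroup.zsmul_mem h e

theorem codiff_mem_locIn {b : Finset ι → T} {s : Finset ι} (hb : ∀ t ⊆ s, b t ∈ locIn M z t) :
    codiff b s ∈ locIn M z s :=
  Submodule.sum_mem _ fun i _ => zsmul_mem_locIn
    (locIn_subset (Finset.erase_subset i s) (hb _ (Finset.erase_subset i s))) _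

/-- The Čech complex of `M[1 / z j]` on `U` is exact when `z j` lies in the radical of the ideal
generated by the `z i` with `i ∈ U`. -/
theorem exists_codiff_eq {U : Finset ι} {j : ι} (hu : IsUnit (algebraMap R T (z j)))
    (hrad : z j ∈ (Ideal.span (z '' U)).radical) {c : Finset ι → T}
    (hc : ∀ s ⊆ U, c s ∈ locIn M z (insert j s)) (hcoc : ∀ s ⊆ U, codiff c s = 0) :
    ∃ b : Finset ι → T, (∀ s ⊆ U, b s ∈ locIn M z (insert j s)) ∧
      ∀ s ⊆ U, codiff b s = c s := by
  -- J consists of the r for which r • c has a primitive. Each `z i` with i ∈ U lies in its radical: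
  -- cone at i and clear the new denominators. Hence a power of `z j` lies in J, and it can be
  -- divided out because every localization used here inverts `z j`.
  let J : Ideal R :=
    { carrier := {r | ∃ b : Finset ι → T, (∀ s ⊆ U, b s ∈ locIn M z (insert j s)) ∧
        ∀ s ⊆ U, codiff b s = r • c s}
      zero_mem' := ⟨0, fun s _ => Submodule.zero_mem _, fun s _ => by simp [codiff]⟩
      add_mem' := by
        rintro r r' ⟨b, hb, hb'⟩ ⟨e, he, he'⟩
        refine ⟨b + e, fun s hs => Submodule.add_mem _ (hb s hs) (he s hs), fun s hs => ?_⟩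
        rw [codiff_add, hb' s hs, he' s hs, add_smul]
      smul_mem' := by
        rintro r r' ⟨b, hb, hb'⟩
        refine ⟨fun s => r • b s, fun s hs => Submodule.smul_mem _ _ (hb s hs), fun s hs => ?_⟩
        have := codiff_map (DistribSMul.toAddMonoidHom T r) b s
        simp only [DistribSMul.toAddMonoidHom_apply] at this
        rw [this, hb' s hs, smul_smul, smul_eq_mul] }
  have hJ : Ideal.span (z '' U) ≤ J.radical := by
    rw [Ideal.span_le]
    rintro _ ⟨i, hi, rfl⟩
    have h1 : ∀ s ∈ U.powerset, ∃ N : ℕ, ∀ N' ≥ N,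
        z i ^ N' • c (insert i s) ∈ locIn M z (insert j s) := by
      intro s hs
      apply exists_pow_smul_mem_locIn
      rw [Finset.insert_comm]
      exact hc _ (Finset.insert_subset hi (Finset.mem_powerset.1 hs))
    choose! N hN using h1
    refine ⟨U.powerset.sup N, fun s => z i ^ U.powerset.sup N • cone i c s, fun s hs => ?_,
      fun s hs => ?_⟩
    · by_cases his : i ∈ s
      · simp [cone_of_mem his]
      · simp only [cone_of_notMem his]
        rw [smul_comm]
        exact zsmul_mem_locIn (hN s (Finset.mem_powerset.2 hs) _
          (Finset.le_sup (f := N) (Finset.mem_powerset.2 hs))) _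
    · have h2 := codiff_cone_add i c s
      have h3 : cone i (codiff c) s = 0 := by
        by_cases his : i ∈ s
        · simp [cone_of_mem his]
        · rw [cone_of_notMem his, hcoc _ (Finset.insert_subset hi hs), smul_zero]
      have := codiff_map (DistribSMul.toAddMonoidHom T (z i ^ U.powerset.sup N)) (cone i c) s
      simp only [DistribSMul.toAddMonoidHom_apply] at this
      rw [this, ← h2, h3, add_zero]
  obtain ⟨L, b, hb, hb'⟩ := Ideal.radical_le_radical_iff.2 hJ hrad
  obtain ⟨v, hv⟩ := (hu.pow L).exists_right_inv
  have hv' : ∀ w : T, z j ^ L • (v * w) = w := by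
    intro w
    rw [Algebra.smul_def, map_pow, ← mul_assoc, hv, one_mul]
  refine ⟨fun s => v * b s, fun s hs => ?_, fun s hs => ?_⟩
  · apply mem_locIn_of_pow_smul (Finset.mem_insert_self j s) (L := L)
    rw [hv']
    exact hb s hs
  · have := codiff_map (AddMonoidHom.mulLeft v) b s
    simp only [AddMonoidHom.coe_mulLeft] at this
    rw [this, hb' s hs, ← hv' (c s), ← mul_smul_comm, hv']

/-- After inverting `z j` the cocycle c acquires a primitive b. Extending b by zero and taking its
differential gives c back on U, and ±b on the sets containing j, where `z j` may be inverted. -/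
theorem exists_cocycle_insert {U : Finset ι} {j : ι} (hu : IsUnit (algebraMap R T (z j)))
    (hrad : z j ∈ (Ideal.span (z '' U)).radical) {c : Finset ι → T}
    (hc : ∀ s ⊆ U, c s ∈ locIn M z s) (hcoc : ∀ s ⊆ U, codiff c s = 0) :
    ∃ c' : Finset ι → T, (∀ s ⊆ insert j U, c' s ∈ locIn M z s) ∧
      (∀ s ⊆ insert j U, codiff c' s = 0) ∧ ∀ s ⊆ U, c' s = c s := by
  by_cases hj : j ∈ U
  · rw [Finset.insert_eq_of_mem hj]
    exact ⟨c, hc, hcoc, fun _ _ => rfl⟩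
  obtain ⟨b, hb, hb'⟩ := exists_codiff_eq hu hrad
    (fun s hs => locIn_subset (Finset.subset_insert j s) (hc s hs)) hcoc
  have key : ∀ s ⊆ U, codiff (dropVertex j b) s = c s := fun s hs => by
    rw [codiff_dropVertex_of_notMem (fun h => hj (hs h)), hb' s hs]
  refine ⟨codiff (dropVertex j b), fun s hs => ?_, fun s _ => codiff_codiff _ s, key⟩
  by_cases hjs : j ∈ s
  · rw [codiff_dropVertex_of_mem hjs]
    have := hb _ (Finset.subset_insert_iff.1 hs)
    rw [Finset.insert_erase hjs] at this
    exact zsmul_mem_locIn this _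
  · have hsU := (Finset.subset_insert_iff_of_notMem hjs).1 hs
    rw [key s hsU]
    exact hc s hsU

/-- A primitive on U reduces to a cocycle vanishing on U. The cone at j is a primitive of it with
denominators in `z j` on subsets of U; there the cone is again a cocycle, and a primitive f of it
repairs the denominators. -/
theorem exists_codiff_eq_insert {U : Finset ι} {j : ι} (hu : IsUnit (algebraMap R T (z j)))
    (hrad : z j ∈ (Ideal.span (z '' U)).radical) {c : Finset ι → T}
    (hc : ∀ s ⊆ insert j U, c s ∈ locIn M z s) (hcoc : ∀ s ⊆ insert j U, codiff c s = 0)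
    (hU : ∃ b : Finset ι → T, (∀ s ⊆ U, b s ∈ locIn M z s) ∧ ∀ s ⊆ U, codiff b s = c s) :
    ∃ b : Finset ι → T, (∀ s ⊆ insert j U, b s ∈ locIn M z s) ∧
      ∀ s ⊆ insert j U, codiff b s = c s := by
  by_cases hj : j ∈ U
  · rw [Finset.insert_eq_of_mem hj]
    exact hU
  obtain ⟨b, hb, hb'⟩ := hU
  have hdrop : ∀ f : Finset ι → T, (∀ s ⊆ U, f s ∈ locIn M z s) →
      ∀ s ⊆ insert j U, dropVertex j f s ∈ locIn M z s := by
    intro f hf s hs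
    by_cases hjs : j ∈ s
    · rw [dropVertex, if_pos hjs]; exact Submodule.zero_mem _
    · rw [dropVertex_of_notMem hjs]
      exact hf s ((Finset.subset_insert_iff_of_notMem hjs).1 hs)
  set c₁ := c - codiff (dropVertex j b) with hc₁
  have hc₁U : ∀ s ⊆ U, c₁ s = 0 := fun s hs => by
    rw [hc₁, Pi.sub_apply, codiff_dropVertex_of_notMem (fun h => hj (hs h)), hb' s hs, sub_self]
  have hc₁mem : ∀ s ⊆ insert j U, c₁ s ∈ locIn M z s := fun s hs =>
    Submodule.sub_mem _ (hc s hs)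
      (codiff_mem_locIn fun t ht => hdrop b hb t (ht.trans hs))
  have hc₁coc : ∀ s ⊆ insert j U, codiff c₁ s = 0 := fun s hs => by
    rw [hc₁, codiff_sub, hcoc s hs, codiff_codiff, sub_zero]
  have hcone : ∀ s ⊆ insert j U, codiff (cone j c₁) s = c₁ s := fun s hs => by
    have h1 := codiff_cone_add j c₁ s
    have h2 : cone j (codiff c₁) s = 0 := by
      by_cases hjs : j ∈ s
      · rw [cone_of_mem hjs]
      · rw [cone_of_notMem hjs, hc₁coc _ (Finset.insert_subset (Finset.mem_insert_self j U) hs),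
          smul_zero]
    rw [h2, add_zero] at h1
    exact h1
  obtain ⟨f, hf, hf'⟩ := exists_codiff_eq (c := cone j c₁) (M := M) hu hrad
    (fun s hs => by
      rw [cone_of_notMem (fun h => hj (hs h))]
      exact zsmul_mem_locIn (hc₁mem _ (Finset.insert_subset_insert j hs)) _)
    (fun s hs => by rw [hcone s (hs.trans (Finset.subset_insert j U)), hc₁U s hs])
  -- The correction is a coboundary, so the differential is unchanged. On sets without j it cancels
  -- the cone exactly; on sets with j the cone is zero and only ±f remains, where `z j` is allowed
  -- in the denominator.
  refine ⟨dropVertex j b + (cone j c₁ - codiff (dropVertex j f)), fun s hs => ?_, fun s hs => ?_⟩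
  · refine Submodule.add_mem _ (hdrop b hb s hs) ?_
    rw [Pi.sub_apply]
    by_cases hjs : j ∈ s
    · rw [cone_of_mem hjs, zero_sub, codiff_dropVertex_of_mem hjs]
      have := hf _ (Finset.subset_insert_iff.1 hs)
      rw [Finset.insert_erase hjs] at this
      exact Submodule.neg_mem _ (zsmul_mem_locIn this _)
    · rw [codiff_dropVertex_of_notMem hjs,
        hf' s ((Finset.subset_insert_iff_of_notMem hjs).1 hs), sub_self]
      exact Submodule.zero_mem _
  · rw [codiff_add, codiff_sub, codiff_codiff, sub_zero, hcone s hs, hc₁, Pi.sub_apply,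
      add_sub_cancel]

theorem radical_span_image_mono {U V : Finset ι} (h : U ⊆ V) :
    (Ideal.span (z '' (U : Set ι))).radical ≤ (Ideal.span (z '' (V : Set ι))).radical :=
  Ideal.radical_mono (Ideal.span_mono (Set.image_mono (Finset.coe_subset.2 h)))

theorem exists_cocycle_union {U W : Finset ι} (hu : ∀ j ∈ W, IsUnit (algebraMap R T (z j)))
    (hrad : ∀ j ∈ W, z j ∈ (Ideal.span (z '' U)).radical) {c : Finset ι → T}
    (hc : ∀ s ⊆ U, c s ∈ locIn M z s) (hcoc : ∀ s ⊆ U, codiff c s = 0) :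
    ∃ c' : Finset ι → T, (∀ s ⊆ W ∪ U, c' s ∈ locIn M z s) ∧
      (∀ s ⊆ W ∪ U, codiff c' s = 0) ∧ ∀ s ⊆ U, c' s = c s := by
  induction W using Finset.induction_on with
  | empty =>
    rw [Finset.empty_union]
    exact ⟨c, hc, hcoc, fun _ _ => rfl⟩
  | insert j W _ ih =>
    obtain ⟨c₁, h1, h2, h3⟩ := ih (fun i hi => hu i (Finset.mem_insert_of_mem hi))
      (fun i hi => hrad i (Finset.mem_insert_of_mem hi))
    obtain ⟨c₂, h4, h5, h6⟩ := exists_cocycle_insert (hu j (Finset.mem_insert_self j W))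
      (radical_span_image_mono Finset.subset_union_right (hrad j (Finset.mem_insert_self j W)))
      h1 h2
    rw [Finset.insert_union]
    exact ⟨c₂, h4, h5, fun s hs => (h6 s (hs.trans Finset.subset_union_right)).trans (h3 s hs)⟩

theorem exists_codiff_eq_union {U W : Finset ι} (hu : ∀ j ∈ W, IsUnit (algebraMap R T (z j)))
    (hrad : ∀ j ∈ W, z j ∈ (Ideal.span (z '' U)).radical) {c : Finset ι → T}
    (hc : ∀ s ⊆ W ∪ U, c s ∈ locIn M z s) (hcoc : ∀ s ⊆ W ∪ U, codiff c s = 0)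
    (hU : ∃ b : Finset ι → T, (∀ s ⊆ U, b s ∈ locIn M z s) ∧ ∀ s ⊆ U, codiff b s = c s) :
    ∃ b : Finset ι → T, (∀ s ⊆ W ∪ U, b s ∈ locIn M z s) ∧
      ∀ s ⊆ W ∪ U, codiff b s = c s := by
  induction W using Finset.induction_on with
  | empty => rwa [Finset.empty_union]
  | insert j W _ ih =>
    rw [Finset.insert_union] at hc hcoc ⊢
    exact exists_codiff_eq_insert (hu j (Finset.mem_insert_self j W))
      (radical_span_image_mono Finset.subset_union_right (hrad j (Finset.mem_insert_self j W)))
      hc hcoc (ih (fun i hi => hu i (Finset.mem_insert_of_mem hi))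
        (fun i hi => hrad i (Finset.mem_insert_of_mem hi))
        (fun s hs => hc s (hs.trans (Finset.subset_insert _ _)))
        (fun s hs => hcoc s (hs.trans (Finset.subset_insert _ _))))

end Comparison

end GradedLC

namespace GradedLC

/-! ### Homogeneous systems of parameters -/

section Parameters

/-- The Krull dimension does not increase along an integral extension. -/
theorem ringKrullDim_le_of_isIntegral (A B : Type*) [CommRing A] [CommRing B] [Algebra A B]
    [Algebra.IsIntegral A B] : ringKrullDim B ≤ ringKrullDim A := by
  refine Order.krullDim_le_of_strictMono (PrimeSpectrum.comap (algebraMap A B)) fun P Q h => ?_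
  have : P.asIdeal < Q.asIdeal := h
  exact Ideal.IsIntegral.comap_lt_comap this

variable {K : Type v} {R : Type u} [Field K] [CommRing R] [Algebra K R]
  (𝒜 : ℕ → Submodule K R) [GradedAlgebra 𝒜]

/-- Homogeneous prime avoidance. -/
theorem exists_homogeneous_notMem (s : Finset (Ideal R))
    (hprime : ∀ P ∈ s, P.IsPrime) (hhom : ∀ P ∈ s, P.IsHomogeneous 𝒜)
    (hanti : ∀ P ∈ s, ∀ Q ∈ s, P ≤ Q → P = Q)
    (hirr : ∀ P ∈ s, ¬ (HomogeneousIdeal.irrelevant 𝒜).toIdeal ≤ P) :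
    ∃ n > 0, ∃ a ∈ 𝒜 n, ∀ P ∈ s, a ∉ P := by
  classical
  induction s using Finset.induction_on with
  | empty => exact ⟨1, one_pos, 0, zero_mem _, by simp⟩
  | insert P s hPs ih =>
    obtain ⟨n, hn, a, ha, has⟩ := ih (fun Q hQ => hprime Q (Finset.mem_insert_of_mem hQ))
      (fun Q hQ => hhom Q (Finset.mem_insert_of_mem hQ))
      (fun Q hQ Q' hQ' => hanti Q (Finset.mem_insert_of_mem hQ) Q' (Finset.mem_insert_of_mem hQ'))
      (fun Q hQ => hirr Q (Finset.mem_insert_of_mem hQ))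
    by_cases haP : a ∈ P
    swap
    · refine ⟨n, hn, a, ha, fun Q hQ => ?_⟩
      rcases Finset.mem_insert.1 hQ with rfl | hQ
      · exact haP
      · exact has Q hQ
    have hP := hprime P (Finset.mem_insert_self P s)
    -- The factor c keeps the degree of the product g below positive even when s is empty or all the
    -- `b Q` have degree 0.
    obtain ⟨k, hk, c, hc, hcP⟩ : ∃ k > 0, ∃ c ∈ 𝒜 k, c ∉ P := by
      by_contra! hcon
      refine hirr P (Finset.mem_insert_self P s) ?_
      rw [HomogeneousIdeal.toIdeal_irrelevant_le]
      exact fun i hi x hx => hcon i hi x hx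
    have hb : ∀ Q ∈ s, ∃ b, SetLike.IsHomogeneousElem 𝒜 b ∧ b ∈ Q ∧ b ∉ P := by
      intro Q hQ
      by_contra! hcon
      have hle : Q ≤ P := by
        intro x hx
        rw [← DirectSum.sum_support_decompose 𝒜 x]
        exact Ideal.sum_mem _ fun i _ => hcon _ ⟨i, SetLike.coe_mem _⟩
          (hhom Q (Finset.mem_insert_of_mem hQ) i hx)
      exact hPs (hanti Q (Finset.mem_insert_of_mem hQ) P (Finset.mem_insert_self P s) hle ▸ hQ)
    choose! b hbhom hbQ hbP using hb
    choose! e he using hbhom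
    have hprod : c * ∏ Q ∈ s, b Q ∈ 𝒜 (k + ∑ Q ∈ s, e Q) :=
      SetLike.mul_mem_graded hc (SetLike.prod_mem_graded _ _ _ fun Q hQ => he Q hQ)
    set l := k + ∑ Q ∈ s, e Q with hl
    set g := c * ∏ Q ∈ s, b Q with hg
    have hlpos : 0 < l := by omega
    have hgP : g ∉ P := by
      intro h
      rcases hP.mem_or_mem h with h | h
      · exact hcP h
      · obtain ⟨Q, hQ, h⟩ := (hP.prod_mem_iff).1 h
        exact hbP Q hQ h
    -- The exponents equalize the degrees. Here a lies in P but in no Q ∈ s, while g lies in every Q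
    -- ∈ s but not in P, so the sum avoids them all.
    refine ⟨l * n, Nat.mul_pos hlpos hn, a ^ l + g ^ n, ?_, ?_⟩
    · refine add_mem ?_ ?_
      · have := SetLike.pow_mem_graded l ha
        rwa [smul_eq_mul] at this
      · have := SetLike.pow_mem_graded n hprod
        rwa [smul_eq_mul, mul_comm] at this
    · intro Q hQ hmem
      rcases Finset.mem_insert.1 hQ with rfl | hQs
      · have h1 : a ^ l ∈ Q := Ideal.pow_mem_of_mem _ haP _ hlpos
        exact hgP (hP.mem_of_pow_mem _ ((Ideal.add_mem_iff_right _ h1).1 hmem))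
      · have hgQ : g ∈ Q := by
          rw [hg, ← Finset.mul_prod_erase s b hQs]
          exact Ideal.mul_mem_left _ _ (Ideal.mul_mem_right _ _ (hbQ Q hQs))
        have h1 : g ^ n ∈ Q := Ideal.pow_mem_of_mem _ hgQ _ hn
        exact has Q hQs ((hprime Q hQ).mem_of_pow_mem _ ((Ideal.add_mem_iff_left _ h1).1 hmem))

variable {𝒜}

/-- The homogeneous core of Q is a prime between I and Q, so minimality makes it equal to Q. -/
theorem isHomogeneous_of_mem_minimalPrimes {I Q : Ideal R} (hI : I.IsHomogeneous 𝒜)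
    (hQ : Q ∈ I.minimalPrimes) : Q.IsHomogeneous 𝒜 := by
  have h1 : (Q.homogeneousCore 𝒜).toIdeal.IsPrime := Ideal.IsPrime.homogeneousCore hQ.1.1
  have h2 : I ≤ (Q.homogeneousCore 𝒜).toIdeal := by
    rw [← hI.toIdeal_homogeneousCore_eq_self]
    exact Ideal.homogeneousCore_mono 𝒜 hQ.1.2
  have h3 : (Q.homogeneousCore 𝒜).toIdeal ≤ Q := Ideal.toIdeal_homogeneousCore_le 𝒜 Q
  have h4 := le_antisymm h3 (hQ.2 ⟨h1, h2⟩ h3)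
  rw [← h4]
  exact (Q.homogeneousCore 𝒜).isHomogeneous

/-- The degree 0 component of an element of Q is a scalar in Q; were it nonzero, Q would contain a
unit. -/
theorem le_irrelevant_of_isHomogeneous (h0 : 𝒜 0 = 1) {Q : Ideal R} (hQ : Q.IsHomogeneous 𝒜)
    (hQ' : Q ≠ ⊤) : Q ≤ (HomogeneousIdeal.irrelevant 𝒜).toIdeal := by
  intro a ha
  change GradedRing.proj 𝒜 0 a = 0
  rw [GradedRing.proj_apply]
  have h1 : ((DirectSum.decompose 𝒜 a 0 : 𝒜 0) : R) ∈ Q := hQ 0 ha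
  have h2 : ((DirectSum.decompose 𝒜 a 0 : 𝒜 0) : R) ∈ (1 : Submodule K R) :=
    h0 ▸ SetLike.coe_mem _
  obtain ⟨c, hc⟩ := Submodule.mem_one.1 h2
  by_contra hne
  have hc0 : c ≠ 0 := by
    rintro rfl
    exact hne (by rw [← hc, map_zero])
  rw [← hc] at h1
  exact hQ' (Ideal.eq_top_of_isUnit_mem _ h1 ((IsUnit.mk0 c hc0).map (algebraMap K R)))

theorem isHomogeneous_span_range {n : ℕ} {t : Fin n → R} {e : Fin n → ℕ}
    (ht : ∀ i, t i ∈ 𝒜 (e i)) : (Ideal.span (Set.range t)).IsHomogeneous 𝒜 :=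
  Ideal.homogeneous_span 𝒜 _ (by rintro _ ⟨i, rfl⟩; exact ⟨e i, ht i⟩)

/-! ### Finiteness of R over the subalgebra generated by parameters. -/

/-- The monomials in `t`, times the elements of `E`. -/
def monomialSpan (K : Type*) {R : Type*} [Field K] [CommRing R] [Algebra K R] {n : ℕ}
    (t : Fin n → R) (E : Set R) : Submodule K R :=
  Submodule.span K {w | ∃ (b : Fin n → ℕ), ∃ g ∈ E, w = (∏ i, t i ^ b i) * g}

theorem mul_mem_monomialSpan {n : ℕ} (t : Fin n → R) (E : Set R) (i : Fin n) {w : R}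
    (hw : w ∈ monomialSpan K t E) : t i * w ∈ monomialSpan K t E := by
  induction hw using Submodule.span_induction with
  | mem w hw =>
    obtain ⟨b, g, hg, rfl⟩ := hw
    refine Submodule.subset_span ⟨b + Pi.single i 1, g, hg, ?_⟩
    simp only [Pi.add_apply, pow_add, Finset.prod_mul_distrib]
    have : ∏ j, t j ^ (Pi.single i 1 : Fin n → ℕ) j = t i := by
      rw [Finset.prod_eq_single i]
      · simp
      · intro j _ hj; simp [hj]
      · simp
    rw [this]; ring
  | zero => simp
  | add a b _ _ ha hb => rw [mul_add]; exact add_mem ha hb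
  | smul c a _ ha => rw [mul_smul_comm]; exact Submodule.smul_mem _ _ ha

/-- Modulo I, components of degree 0 are scalars and components of positive degree are nilpotent.
Together with finite type this makes R/I finite-dimensional over K. -/
theorem isIntegral_quotient (h0 : 𝒜 0 = 1) {I : Ideal R}
    (hI : (HomogeneousIdeal.irrelevant 𝒜).toIdeal ≤ I.radical) :
    Algebra.IsIntegral K (R ⧸ I) := by
  classical
  refine ⟨fun x => ?_⟩
  obtain ⟨r, rfl⟩ := Ideal.Quotient.mk_surjective x
  rw [← DirectSum.sum_support_decompose 𝒜 r, map_sum]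
  refine IsIntegral.sum _ fun i _ => ?_
  rcases Nat.eq_zero_or_pos i with rfl | hi
  · have h2 : ((DirectSum.decompose 𝒜 r 0 : 𝒜 0) : R) ∈ (1 : Submodule K R) :=
      h0 ▸ SetLike.coe_mem _
    obtain ⟨c, hc⟩ := Submodule.mem_one.1 h2
    rw [← hc]
    exact isIntegral_algebraMap (R := K) (A := R ⧸ I) (x := c)
  · obtain ⟨N, hN⟩ := hI (HomogeneousIdeal.mem_irrelevant_of_mem 𝒜 hi
      (SetLike.coe_mem (DirectSum.decompose 𝒜 r i)))
    refine IsIntegral.of_pow (n := N + 1) (Nat.succ_pos N) ?_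
    rw [← map_pow, Ideal.Quotient.eq_zero_iff_mem.2]
    · exact isIntegral_zero
    · rw [pow_succ]; exact Ideal.mul_mem_right _ _ hN

/-- If the homogeneous elements `t` generate the irrelevant ideal up to radical, then `R` is
spanned by finitely many homogeneous elements over `K[t]`. -/
theorem exists_monomialSpan_eq_top [Algebra.FiniteType K R] (h0 : 𝒜 0 = 1) {n : ℕ}
    {t : Fin n → R} {e : Fin n → ℕ} (ht : ∀ i, t i ∈ 𝒜 (e i)) (he : ∀ i, 0 < e i)
    (hrad : (HomogeneousIdeal.irrelevant 𝒜).toIdeal ≤ (Ideal.span (Set.range t)).radical) :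
    ∃ E : Finset R, (∀ g ∈ E, SetLike.IsHomogeneousElem 𝒜 g) ∧
      monomialSpan K t (E : Set R) = ⊤ := by
  classical
  set I := Ideal.span (Set.range t) with hI
  have := isIntegral_quotient h0 hrad
  have : Algebra.FiniteType K (R ⧸ I) :=
    Algebra.FiniteType.of_surjective (Ideal.Quotient.mkₐ K I) (Ideal.Quotient.mkₐ_surjective K I)
  have : Module.Finite K (R ⧸ I) := Algebra.IsIntegral.finite
  obtain ⟨F, hF⟩ := (Module.Finite.fg_top : (⊤ : Submodule K (R ⧸ I)).FG)
  let lft : R ⧸ I → R := fun x => (Ideal.Quotient.mk_surjective x).choose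
  have hlft : ∀ x, Ideal.Quotient.mk I (lft x) = x :=
    fun x => (Ideal.Quotient.mk_surjective x).choose_spec
  -- E collects the homogeneous components of lifts of generators of R/I, so that its span is stable
  -- under projection to each degree.
  let E : Finset R := F.biUnion fun x =>
    (DirectSum.decompose 𝒜 (lft x)).support.image fun i => (DirectSum.decompose 𝒜 (lft x) i : R)
  have hE : ∀ g ∈ E, SetLike.IsHomogeneousElem 𝒜 g := by
    intro g hg
    simp only [E, Finset.mem_biUnion, Finset.mem_image] at hg
    obtain ⟨x, _, i, _, rfl⟩ := hg
    exact ⟨i, SetLike.coe_mem _⟩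
  refine ⟨E, hE, ?_⟩
  have hspan : ∀ r : R, ∃ r₀ ∈ Submodule.span K (E : Set R), r - r₀ ∈ I := by
    intro r
    have h1 : Ideal.Quotient.mk I r ∈ Submodule.span K (F : Set (R ⧸ I)) := hF ▸ trivial
    have h2 : Submodule.span K (F : Set (R ⧸ I)) ≤
        (Submodule.span K (E : Set R)).map (Ideal.Quotient.mkₐ K I).toLinearMap := by
      rw [Submodule.span_le]
      intro x hx
      refine ⟨lft x, ?_, hlft x⟩
      rw [SetLike.mem_coe, ← DirectSum.sum_support_decompose 𝒜 (lft x)]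
      refine Submodule.sum_mem _ fun i hi => Submodule.subset_span ?_
      exact Finset.mem_biUnion.2 ⟨x, hx, Finset.mem_image.2 ⟨i, hi, rfl⟩⟩
    obtain ⟨r₀, hr₀, hr⟩ := h2 h1
    refine ⟨r₀, hr₀, ?_⟩
    rw [← Ideal.Quotient.eq_zero_iff_mem, map_sub, sub_eq_zero]
    exact hr.symm
  have hproj : ∀ m, ∀ r ∈ Submodule.span K (E : Set R),
      (DirectSum.decompose 𝒜 r m : R) ∈ Submodule.span K (E : Set R) := by
    intro m r hr
    induction hr using Submodule.span_induction with
    | mem g hg =>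
      obtain ⟨i, hi⟩ := hE g hg
      by_cases him : i = m
      · subst him
        rw [DirectSum.decompose_of_mem_same 𝒜 hi]
        exact Submodule.subset_span hg
      · rw [DirectSum.decompose_of_mem_ne 𝒜 hi him]
        exact zero_mem _
    | zero => simp
    | add a b _ _ ha hb =>
      rw [DirectSum.decompose_add, DirectSum.add_apply, Submodule.coe_add]
      exact add_mem ha hb
    | smul c a _ ha =>
      rw [DirectSum.decompose_smul, DirectSum.smul_apply, Submodule.coe_smul]
      exact Submodule.smul_mem _ _ ha
  have hsub : Submodule.span K (E : Set R) ≤ monomialSpan K t (E : Set R) :=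
    Submodule.span_mono fun g hg => ⟨0, g, hg, by simp⟩
  -- Graded Nakayama: the degree m part of r = r₀ + ∑ q_i t_i involves only components of q_i of
  -- degree m - e_i < m, which induction covers.
  have key : ∀ m, ∀ r ∈ 𝒜 m, r ∈ monomialSpan K t (E : Set R) := by
    intro m
    induction m using Nat.strong_induction_on with
    | _ m ih =>
      intro r hr
      obtain ⟨r₀, hr₀, hr'⟩ := hspan r
      obtain ⟨q, hq⟩ := (Ideal.mem_span_range_iff_exists_fun).1 hr'
      have h1 : r = (DirectSum.decompose 𝒜 r₀ m : R) +
          ∑ i, (DirectSum.decompose 𝒜 (q i * t i) m : R) := by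
        have h2 : r = r₀ + ∑ i, q i * t i := by rw [hq]; ring
        conv_lhs => rw [← DirectSum.decompose_of_mem_same 𝒜 hr, h2]
        rw [DirectSum.decompose_add, DirectSum.add_apply, Submodule.coe_add,
          DirectSum.decompose_sum, DFinsupp.finsetSum_apply, AddSubmonoidClass.coe_finsetSum]
      rw [h1]
      refine add_mem (hsub (hproj m r₀ hr₀)) (Submodule.sum_mem _ fun i _ => ?_)
      by_cases him : e i ≤ m
      · rw [DirectSum.coe_decompose_mul_of_right_mem_of_le 𝒜 (ht i) him, mul_comm]
        exact mul_mem_monomialSpan t _ i (ih (m - e i) (by have := he i; omega) _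
          (SetLike.coe_mem _))
      · rw [DirectSum.coe_decompose_mul_of_right_mem_of_not_le 𝒜 (ht i) him]
        exact zero_mem _
  rw [eq_top_iff]
  intro r _
  rw [← DirectSum.sum_support_decompose 𝒜 r]
  exact Submodule.sum_mem _ fun i _ => key i _ (SetLike.coe_mem _)

/-- R is module-finite over the image of a polynomial ring in n variables over K, and neither a
quotient nor an integral extension raises the dimension. -/
theorem ringKrullDim_le_of_monomialSpan {n : ℕ} {t : Fin n → R} {E : Finset R}
    (h : monomialSpan K t (E : Set R) = ⊤) : ringKrullDim R ≤ n := by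
  let A := (MvPolynomial.aeval t : MvPolynomial (Fin n) K →ₐ[K] R).range
  have htop : Submodule.span A (E : Set R) = ⊤ := by
    rw [eq_top_iff]
    intro r _
    have hr : r ∈ monomialSpan K t (E : Set R) := h ▸ trivial
    have h2 : monomialSpan K t (E : Set R) ≤ (Submodule.span A (E : Set R)).restrictScalars K := by
      refine Submodule.span_le.2 ?_
      rintro _ ⟨b, g, hg, rfl⟩
      have hb : ∏ i, t i ^ b i ∈ A := by
        refine Subalgebra.prod_mem _ fun i _ => Subalgebra.pow_mem _ ?_ _
        exact (AlgHom.mem_range _).2 ⟨MvPolynomial.X i, by simp⟩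
      exact Submodule.smul_mem _ (⟨_, hb⟩ : A) (Submodule.subset_span hg)
    exact h2 hr
  have : Module.Finite A R := ⟨⟨E, htop⟩⟩
  calc ringKrullDim R ≤ ringKrullDim A := ringKrullDim_le_of_isIntegral A R
    _ ≤ ringKrullDim (MvPolynomial (Fin n) K) :=
      ringKrullDim_le_of_surjective
        (MvPolynomial.aeval t : MvPolynomial (Fin n) K →ₐ[K] R).rangeRestrict.toRingHom
        (AlgHom.rangeRestrict_surjective _)
    _ ≤ n := by
      rw [MvPolynomial.ringKrullDim_of_isNoetherianRing, ringKrullDim_eq_zero_of_field]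
      simp

/-! ### Construction of homogeneous parameters. -/

/-- Either the first `n` members of a homogeneous sequence of parameters can be found such that
all minimal primes over them have height at least `n`, or fewer of them already generate the
irrelevant ideal up to radical. -/
theorem exists_parameters_or [IsDomain R] [IsNoetherianRing R] (h0 : 𝒜 0 = 1) (n : ℕ) :
    (∃ m < n, ∃ (t : Fin m → R) (e : Fin m → ℕ), (∀ i, 0 < e i ∧ t i ∈ 𝒜 (e i) ∧ t i ≠ 0) ∧
      (HomogeneousIdeal.irrelevant 𝒜).toIdeal ≤ (Ideal.span (Set.range t)).radical ∧
      (m : ℕ∞) ≤ (HomogeneousIdeal.irrelevant 𝒜).toIdeal.height) ∨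
    ∃ (t : Fin n → R) (e : Fin n → ℕ), (∀ i, 0 < e i ∧ t i ∈ 𝒜 (e i) ∧ t i ≠ 0) ∧
      ∀ Q ∈ (Ideal.span (Set.range t)).minimalPrimes, (n : ℕ∞) ≤ Q.height := by
  induction n with
  | zero =>
    exact Or.inr ⟨Fin.elim0, Fin.elim0, fun i => i.elim0, fun Q _ => by simp⟩
  | succ n ih =>
    rcases ih with ⟨m, hm, h⟩ | ⟨t, e, ht, hQ⟩
    · exact Or.inl ⟨m, hm.trans n.lt_succ_self, h⟩
    have hhom := isHomogeneous_span_range (𝒜 := 𝒜) fun i => (ht i).2.1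
    by_cases hmin : ∃ Q ∈ (Ideal.span (Set.range t)).minimalPrimes,
        (HomogeneousIdeal.irrelevant 𝒜).toIdeal ≤ Q
    · obtain ⟨Q, hQmin, hQle⟩ := hmin
      have hQeq : ∀ Q' ∈ (Ideal.span (Set.range t)).minimalPrimes,
          Q' ≤ (HomogeneousIdeal.irrelevant 𝒜).toIdeal := fun Q' hQ' =>
        le_irrelevant_of_isHomogeneous h0 (isHomogeneous_of_mem_minimalPrimes hhom hQ')
          hQ'.1.1.ne_top
      have hEq : Q = (HomogeneousIdeal.irrelevant 𝒜).toIdeal := le_antisymm (hQeq Q hQmin) hQle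
      refine Or.inl ⟨n, n.lt_succ_self, t, e, ht, ?_, hEq ▸ hQ Q hQmin⟩
      -- Every minimal prime lies in 𝔪, which is itself the minimal prime Q; hence 𝔪 is the only one
      -- and equals the radical.
      rw [← Ideal.sInf_minimalPrimes]
      refine le_sInf fun Q' hQ' => ?_
      rw [← hEq]
      exact hQmin.2 hQ'.1 (hEq ▸ hQeq Q' hQ')
    · push Not at hmin
      have hfin := (Ideal.span (Set.range t)).finite_minimalPrimes_of_isNoetherianRing R
      obtain ⟨k, hk, a, ha, haQ⟩ := exists_homogeneous_notMem 𝒜 hfin.toFinset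
        (fun P hP => ((Set.Finite.mem_toFinset _).1 hP).1.1)
        (fun P hP => isHomogeneous_of_mem_minimalPrimes hhom ((Set.Finite.mem_toFinset _).1 hP))
        (fun P hP Q hQ hPQ => le_antisymm hPQ
          (((Set.Finite.mem_toFinset _).1 hQ).2 ((Set.Finite.mem_toFinset _).1 hP).1 hPQ))
        (fun P hP => hmin P ((Set.Finite.mem_toFinset _).1 hP))
      -- The zero element belongs to every prime, and there is at least one minimal prime because t
      -- generates a proper ideal.
      have hane : a ≠ 0 := by
        rintro rfl
        have hne : Ideal.span (Set.range t) ≠ ⊤ := by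
          intro h
          have hle : Ideal.span (Set.range t) ≤ (HomogeneousIdeal.irrelevant 𝒜).toIdeal := by
            rw [Ideal.span_le]
            rintro _ ⟨i, rfl⟩
            exact HomogeneousIdeal.mem_irrelevant_of_mem 𝒜 (ht i).1 (ht i).2.1
          rw [h, top_le_iff, Ideal.eq_top_iff_one] at hle
          have h1 : GradedRing.proj 𝒜 0 (1 : R) = 0 := hle
          rw [GradedRing.proj_apply, DirectSum.decompose_of_mem_same 𝒜 SetLike.GradedOne.one_mem]
            at h1
          exact one_ne_zero h1
        obtain ⟨Q, hQ⟩ := Ideal.nonempty_minimalPrimes hne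
        exact haQ Q (hfin.mem_toFinset.2 hQ) (zero_mem Q)
      refine Or.inr ⟨Fin.snoc t a, Fin.snoc e k, fun i => ?_, fun Q' hQ' => ?_⟩
      · refine Fin.lastCases ?_ (fun i => ?_) i
        · simp only [Fin.snoc_last]; exact ⟨hk, ha, hane⟩
        · simp only [Fin.snoc_castSucc]; exact ht i
      · have hle : Ideal.span (Set.range t) ≤ Q' := by
          refine le_trans (Ideal.span_mono ?_) hQ'.1.2
          rintro _ ⟨i, rfl⟩
          exact ⟨i.castSucc, by simp⟩
        have := hQ'.1.1
        obtain ⟨Q, hQmin, hQQ'⟩ := Ideal.exists_minimalPrimes_le hle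
        have haQ' : a ∈ Q' := hQ'.1.2 (Ideal.subset_span ⟨Fin.last n, by simp⟩)
        have hlt : Q < Q' := lt_of_le_of_ne hQQ' fun h =>
          haQ Q (hfin.mem_toFinset.2 hQmin) (h ▸ haQ')
        have := hQmin.1.1
        calc ((n + 1 : ℕ) : ℕ∞) = (n : ℕ∞) + 1 := by push_cast; rfl
          _ ≤ Q.height + 1 := by gcongr; exact hQ Q hQmin
          _ ≤ Q'.height := Ideal.height_add_one_le_of_lt_of_isPrime hlt

/-- A graded domain of dimension `d` that is finitely generated over the field `R_0` has a
homogeneous system of parameters of length `d`. -/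
theorem exists_homogeneous_parameters [IsDomain R] [Algebra.FiniteType K R] (h0 : 𝒜 0 = 1) {d : ℕ}
    (hd : ringKrullDim R = d) :
    ∃ (t : Fin d → R) (e : Fin d → ℕ), (∀ i, 0 < e i ∧ t i ∈ 𝒜 (e i) ∧ t i ≠ 0) ∧
      (HomogeneousIdeal.irrelevant 𝒜).toIdeal ≤ (Ideal.span (Set.range t)).radical := by
  have : IsNoetherianRing R := Algebra.FiniteType.isNoetherianRing K R
  have hbound : ∀ (I : Ideal R) (m : ℕ), I ≠ ⊤ → (m : ℕ∞) ≤ I.height → m ≤ d := by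
    intro I m hI hm
    have h1 := Ideal.height_le_ringKrullDim_of_ne_top hI
    rw [hd] at h1
    have h2 : ((m : ℕ∞) : WithBot ℕ∞) ≤ d := (WithBot.coe_le_coe.2 hm).trans h1
    exact_mod_cast h2
  have hirr : (HomogeneousIdeal.irrelevant 𝒜).toIdeal ≠ ⊤ := by
    rw [Ne, Ideal.eq_top_iff_one]
    intro h
    have h1 : GradedRing.proj 𝒜 0 (1 : R) = 0 := h
    rw [GradedRing.proj_apply, DirectSum.decompose_of_mem_same 𝒜 SetLike.GradedOne.one_mem] at h1
    exact one_ne_zero h1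
  -- Asking for d + 1 parameters excludes the second alternative, which would yield a prime of
  -- height above d. In the first, m ≤ d by construction and d ≤ m by finiteness over K[t].
  rcases exists_parameters_or h0 (d + 1) (𝒜 := 𝒜) with ⟨m, hm, t, e, ht, hrad, hht⟩ | ⟨t, e, ht, hQ⟩
  · obtain ⟨E, _, hE⟩ := exists_monomialSpan_eq_top h0 (fun i => (ht i).2.1) (fun i => (ht i).1) hrad
    have h1 := ringKrullDim_le_of_monomialSpan hE
    rw [hd] at h1
    have h2 : d ≤ m := by exact_mod_cast h1
    obtain rfl : m = d := le_antisymm (by omega) h2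
    exact ⟨t, e, ht, hrad⟩
  · exfalso
    have hle : Ideal.span (Set.range t) ≤ (HomogeneousIdeal.irrelevant 𝒜).toIdeal := by
      rw [Ideal.span_le]
      rintro _ ⟨i, rfl⟩
      exact HomogeneousIdeal.mem_irrelevant_of_mem 𝒜 (ht i).1 (ht i).2.1
    obtain ⟨Q, hQmin⟩ := Ideal.nonempty_minimalPrimes (fun h => hirr (top_le_iff.1 (h ▸ hle)))
    have := hbound Q (d + 1) hQmin.1.1.ne_top (hQ Q hQmin)
    omega

end Parameters

end GradedLC

namespace GradedLC

/-! ### Top local cohomology inside a graded extension with many units -/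

/-! ### Additive polynomials in Frobenius powers. -/

section FrobeniusPolynomial

variable (K : Type*) {T : Type*} [Field K] [CommRing T] [Algebra K T]

/-- The additive polynomial `y ↦ y ^ (p ^ e) + ∑ i < e, c i • y ^ (p ^ i)`. -/
def frobPoly (p : ℕ) [ExpChar T p] (e : ℕ) (c : ℕ → K) : T →+ T :=
  (iterateFrobenius T p e).toAddMonoidHom +
    ∑ i ∈ Finset.range e, (DistribSMul.toAddMonoidHom T (c i)).comp
      (iterateFrobenius T p i).toAddMonoidHom

theorem frobPoly_apply (p : ℕ) [ExpChar T p] (e : ℕ) (c : ℕ → K) (y : T) :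
    frobPoly K p e c y = y ^ p ^ e + ∑ i ∈ Finset.range e, c i • y ^ p ^ i := by
  simp [frobPoly, iterateFrobenius_def]

end FrobeniusPolynomial

theorem degree_sum_sub_C_lt {R : Type*} [CommRing R] [Nontrivial R] {p : ℕ} (hp : 1 < p) (e : ℕ)
    (c : ℕ → R) (r : R) :
    (∑ i ∈ Finset.range e, C (c i) * X ^ p ^ i - C r).degree < (p ^ e : ℕ) := by
  refine lt_of_le_of_lt (degree_sub_le _ _) (max_lt ?_ ?_)
  · refine lt_of_le_of_lt (degree_sum_le _ _) ?_
    rw [Finset.sup_lt_iff (WithBot.bot_lt_coe _)]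
    intro i hi
    refine lt_of_le_of_lt (degree_C_mul_X_pow_le _ _) ?_
    exact_mod_cast Nat.pow_lt_pow_right hp (Finset.mem_range.1 hi)
  · refine lt_of_le_of_lt degree_C_le ?_
    exact_mod_cast Nat.pow_pos (by omega)

/-- For p > 1 the term of exponent p^e dominates, so the equation is already a monic one for y. -/
theorem isIntegral_of_pow_add_sum_eq {R T : Type*} [CommRing R] [CommRing T] [Algebra R T]
    {p : ℕ} (hp : 1 < p) (e : ℕ) (c : ℕ → R) {y : T} {r : R}
    (h : y ^ p ^ e + ∑ i ∈ Finset.range e, algebraMap R T (c i) * y ^ p ^ i = algebraMap R T r) :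
    IsIntegral R y := by
  nontriviality R
  refine ⟨X ^ p ^ e + (∑ i ∈ Finset.range e, C (c i) * X ^ p ^ i - C r),
    monic_X_pow_add (degree_sum_sub_C_lt hp e c r), ?_⟩
  rw [← aeval_def]
  simp only [map_add, map_sub, map_sum, map_mul, map_pow, aeval_X, aeval_C]
  rw [← h]; ring

/-! ### Top cohomology modulo faces, its finiteness, and the equational lemma. -/

section Host

set_option linter.unusedSectionVars false

variable {K : Type v} {R : Type u} {T : Type w} [Field K] [CommRing R] [Algebra K R]
  [CommRing T] [Algebra R T] {σ : Type*} [SetLike σ T] [AddSubgroupClass σ T]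
  {𝒯 : ℚ → σ} [GradedRing 𝒯] {𝒜 : ℕ → Submodule K R}

theorem mem_of_mul_mem {a w : T} (ha : IsUnit a) {D q : ℚ} (haD : a ∈ 𝒯 D) (h : a * w ∈ 𝒯 (D + q)) :
    w ∈ 𝒯 q := by
  have h1 := DirectSum.coe_decompose_mul_add_of_left_mem 𝒯 (b := w) (j := q) haD
  rw [DirectSum.decompose_of_mem_same 𝒯 h] at h1
  rw [ha.mul_left_cancel h1]
  exact SetLike.coe_mem _

/-- The denominator is homogeneous, so clearing it only shifts degrees and commutes with taking
components; M is graded by `hM`. -/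
theorem decompose_mem_locIn {ι : Type*} [LinearOrder ι] {M : Submodule R T}
    (hM : ∀ v ∈ M, ∀ q, (DirectSum.decompose 𝒯 v q : T) ∈ M) {z : ι → R} {δ : ι → ℚ}
    {s : Finset ι} (hz : ∀ i ∈ s, algebraMap R T (z i) ∈ 𝒯 (δ i)) {w : T}
    (hw : w ∈ locIn M z s) (q : ℚ) : (DirectSum.decompose 𝒯 w q : T) ∈ locIn M z s := by
  obtain ⟨N, hN⟩ := hw
  refine ⟨N, ?_⟩
  have ha : algebraMap R T ((∏ i ∈ s, z i) ^ N) ∈ 𝒯 (N • ∑ i ∈ s, δ i) := by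
    rw [map_pow, map_prod]
    exact SetLike.pow_mem_graded _ (SetLike.prod_mem_graded _ _ _ hz)
  rw [Algebra.smul_def, ← DirectSum.coe_decompose_mul_add_of_left_mem 𝒯 ha, ← Algebra.smul_def]
  exact hM _ hN _

/-- The properties of a graded extension in which the equational lemma for the Frobenius
can be applied. -/
structure IsHost [Algebra K T] (𝒜 : ℕ → Submodule K R) (𝒯 : ℚ → σ) (p : ℕ) [ExpChar T p] :
    Prop where
  algebraMap_mem : ∀ i, ∀ r ∈ 𝒜 i, algebraMap R T r ∈ 𝒯 (i : ℚ)
  isUnit_algebraMap : ∀ i, ∀ r ∈ 𝒜 i, r ≠ 0 → IsUnit (algebraMap R T r)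
  -- On degree m the terms of the additive polynomial have degrees p^i m, so it is homogeneous only
  -- for m = 0 or when the leading term stands alone.
  exists_root : ∀ (m : ℚ) (e : ℕ) (c : ℕ → K), (m = 0 ∨ ∀ i, c i = 0) →
    ∀ β ∈ 𝒯 ((p ^ e : ℕ) * m), ∃ y ∈ 𝒯 m, frobPoly K p e c y = β

theorem decompose_mem_bot [GradedAlgebra 𝒜]
    (hmap : ∀ i, ∀ r ∈ 𝒜 i, algebraMap R T r ∈ 𝒯 (i : ℚ)) :
    ∀ v ∈ Subalgebra.toSubmodule (⊥ : Subalgebra R T), ∀ q,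
      (DirectSum.decompose 𝒯 v q : T) ∈ Subalgebra.toSubmodule (⊥ : Subalgebra R T) := by
  classical
  intro v hv q
  obtain ⟨r, rfl⟩ := Algebra.mem_bot.1 hv
  rw [← DirectSum.sum_support_decompose 𝒜 r, map_sum, DirectSum.decompose_sum,
    DFinsupp.finsetSum_apply, AddSubmonoidClass.coe_finsetSum]
  refine Submodule.sum_mem _ fun i _ => ?_
  have hi := hmap i _ (SetLike.coe_mem (DirectSum.decompose 𝒜 r i))
  by_cases hq : (i : ℚ) = q
  · subst hq
    rw [DirectSum.decompose_of_mem_same 𝒯 hi]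
    exact Algebra.mem_bot.2 ⟨_, rfl⟩
  · rw [DirectSum.decompose_of_mem_ne 𝒯 hi hq]
    exact zero_mem _

theorem pow_mem_locIn {ι : Type*} [LinearOrder ι] {S : Subalgebra R T} {z : ι → R} {s : Finset ι}
    {w : T} (hw : w ∈ locIn (Subalgebra.toSubmodule S) z s) (n : ℕ) :
    w ^ n ∈ locIn (Subalgebra.toSubmodule S) z s := by
  obtain ⟨N, hN⟩ := hw
  refine ⟨N * n, ?_⟩
  rw [pow_mul, ← _root_.smul_pow]
  exact S.pow_mem hN n

/-- The cochains `∑ i, M[1 / ∏ j ≠ i, t j]` inside `M[1 / ∏ j, t j]`. -/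
def faceSum {d : ℕ} (M : Submodule R T) (t : Fin d → R) : Submodule R T :=
  ⨆ i, locIn M t (Finset.univ.erase i)

theorem mem_faceSum {d : ℕ} {M : Submodule R T} {t : Fin d → R} {w : T} :
    w ∈ faceSum M t ↔ ∃ β : Fin d → T, (∀ i, β i ∈ locIn M t (Finset.univ.erase i)) ∧
      ∑ i, β i = w := by
  constructor
  · intro h
    have h' : w ∈ ⨆ i ∈ (Finset.univ : Finset (Fin d)), locIn M t (Finset.univ.erase i) := by
      simpa [faceSum] using h
    obtain ⟨μ, hμ⟩ := (Submodule.mem_iSup_finset_iff_exists_sum _ _).1 h'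
    exact ⟨fun i => μ i, fun i => (μ i).2, hμ⟩
  · rintro ⟨β, hβ, rfl⟩
    exact Submodule.sum_mem _ fun i _ => (le_iSup (fun i => locIn M t (Finset.univ.erase i)) i)
      (hβ i)

theorem decompose_mem_faceSum {d : ℕ} {M : Submodule R T}
    (hM : ∀ v ∈ M, ∀ q, (DirectSum.decompose 𝒯 v q : T) ∈ M) {t : Fin d → R} {δ : Fin d → ℚ}
    (ht : ∀ i, algebraMap R T (t i) ∈ 𝒯 (δ i)) {w : T} {q : ℚ} (hw : w ∈ faceSum M t) :
    ∃ β : Fin d → T, (∀ i, β i ∈ locIn M t (Finset.univ.erase i) ∧ β i ∈ 𝒯 q) ∧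
      ∑ i, β i = (DirectSum.decompose 𝒯 w q : T) := by
  obtain ⟨β, hβ, rfl⟩ := mem_faceSum.1 hw
  refine ⟨fun i => (DirectSum.decompose 𝒯 (β i) q : T),
    fun i => ⟨decompose_mem_locIn hM (fun j _ => ht j) (hβ i) q, SetLike.coe_mem _⟩, ?_⟩
  rw [DirectSum.decompose_sum, DFinsupp.finsetSum_apply, AddSubmonoidClass.coe_finsetSum]

variable [Algebra K T] [IsScalarTower K R T]

theorem algebraMap_mem_zero (h0 : 𝒜 0 = 1)
    (hmap : ∀ i, ∀ r ∈ 𝒜 i, algebraMap R T r ∈ 𝒯 (i : ℚ)) (c : K) : algebraMap K T c ∈ 𝒯 0 := by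
  have h1 : algebraMap K R c ∈ 𝒜 0 := by rw [h0]; exact Submodule.mem_one.2 ⟨c, rfl⟩
  have := hmap 0 _ h1
  rwa [← IsScalarTower.algebraMap_apply, Nat.cast_zero] at this

theorem decompose_smul_of_host (h0 : 𝒜 0 = 1)
    (hmap : ∀ i, ∀ r ∈ 𝒜 i, algebraMap R T r ∈ 𝒯 (i : ℚ)) (c : K) (v : T) (q : ℚ) :
    (DirectSum.decompose 𝒯 (c • v) q : T) = c • (DirectSum.decompose 𝒯 v q : T) := by
  rw [Algebra.smul_def, Algebra.smul_def,
    DirectSum.coe_decompose_mul_of_left_mem_zero 𝒯 (algebraMap_mem_zero h0 hmap c)]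

/-- In nonnegative degrees, `M[1 / ∏ t] / ∑ M[1 / ∏ j ≠ i, t j]` for `M = R` is spanned by finitely
many classes of bounded degree. -/
theorem exists_finset_span [GradedAlgebra 𝒜] (h0 : 𝒜 0 = 1)
    (hmap : ∀ i, ∀ r ∈ 𝒜 i, algebraMap R T r ∈ 𝒯 (i : ℚ)) {d : ℕ}
    {t : Fin d → R} {e : Fin d → ℕ} (ht : ∀ i, t i ∈ 𝒜 (e i)) (he : ∀ i, 0 < e i)
    (hu : ∀ i, IsUnit (algebraMap R T (t i)))
    {E : Finset R} (hE : ∀ g ∈ E, SetLike.IsHomogeneousElem 𝒜 g)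
    (hEtop : monomialSpan K t (E : Set R) = ⊤) :
    ∃ (B : ℕ) (F : Finset T),
      (∀ v ∈ F, v ∈ locIn (Subalgebra.toSubmodule (⊥ : Subalgebra R T)) t Finset.univ) ∧
      (∀ v ∈ F, ∀ q, v ∈ 𝒯 q → v ≠ 0 → q ≤ B) ∧
      ∀ (m : ℚ), 0 ≤ m → ∀ w ∈ 𝒯 m,
        w ∈ locIn (Subalgebra.toSubmodule (⊥ : Subalgebra R T)) t Finset.univ →
        w ∈ (faceSum (Subalgebra.toSubmodule (⊥ : Subalgebra R T)) t).restrictScalars K ⊔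
          Submodule.span K {v | v ∈ F ∧ v ∈ 𝒯 m ∧ v ≠ 0} := by
  classical
  set M := Subalgebra.toSubmodule (⊥ : Subalgebra R T) with hMdef
  have hM := decompose_mem_bot (𝒯 := 𝒯) (T := T) hmap
  choose u hu' using fun i => (hu i).exists_right_inv
  choose! δ hδ using hE
  obtain ⟨B, hB⟩ : ∃ B : ℕ, ∀ g ∈ E, δ g ≤ B := ⟨E.sup δ, fun g hg => Finset.le_sup hg⟩
  -- The fraction g/∏ t_i^(b_i+1). The shift by 1 keeps every t_i in the denominator; a fraction
  -- missing some t_i is already in `faceSum`.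
  let V : (Fin d → ℕ) → R → T := fun b g => (∏ i, u i ^ (b i + 1)) * algebraMap R T g
  have hVmul : ∀ b g, algebraMap R T (∏ i, t i ^ (b i + 1)) * V b g = algebraMap R T g := by
    intro b g
    simp only [V]
    rw [← mul_assoc, map_prod, ← Finset.prod_mul_distrib, Finset.prod_eq_one, one_mul]
    intro i _
    rw [map_pow, ← mul_pow, hu', one_pow]
  have hprodunit : ∀ b : Fin d → ℕ, IsUnit (algebraMap R T (∏ i, t i ^ (b i))) := by
    intro b
    rw [map_prod]
    refine (IsUnit.prod_univ_iff).2 fun i => ?_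
    rw [map_pow]; exact (hu i).pow _
  have hproddeg : ∀ b : Fin d → ℕ, algebraMap R T (∏ i, t i ^ (b i)) ∈
      𝒯 (∑ i, (b i : ℚ) * e i) := by
    intro b
    rw [map_prod]
    refine SetLike.prod_mem_graded _ _ _ fun i _ => ?_
    rw [map_pow]
    have := SetLike.pow_mem_graded (b i) (hmap _ _ (ht i))
    rwa [nsmul_eq_mul] at this
  have hVdeg : ∀ b, ∀ g ∈ E, V b g ∈ 𝒯 (δ g - ∑ i, ((b i : ℚ) + 1) * e i) := by
    intro b g hg
    have h1 : algebraMap R T (∏ i, t i ^ (b i + 1)) ∈ 𝒯 (∑ i, ((b i : ℚ) + 1) * e i) := by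
      simpa only [Nat.cast_add, Nat.cast_one] using hproddeg fun i => b i + 1
    refine mem_of_mul_mem (hprodunit fun i => b i + 1) h1 ?_
    rw [hVmul, add_sub_cancel]
    exact hmap _ _ (hδ g hg)
  have hVloc : ∀ b g, V b g ∈ locIn M t Finset.univ := by
    intro b g
    refine ⟨∑ i, (b i + 1), Algebra.mem_bot.2 ⟨(∏ i, t i ^ ((∑ j, (b j + 1)) - (b i + 1))) * g, ?_⟩⟩
    rw [map_mul, ← hVmul b g, ← mul_assoc, ← map_mul, ← Finset.prod_mul_distrib, Algebra.smul_def,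
      ← Finset.prod_pow]
    congr 3
    ext i
    rw [← pow_add, Nat.sub_add_cancel]
    exact Finset.single_le_sum (f := fun j => b j + 1) (fun _ _ => Nat.zero_le _)
      (Finset.mem_univ i)
  have huniq : ∀ v : T, v ≠ 0 → ∀ q q', v ∈ 𝒯 q → v ∈ 𝒯 q' → q = q' := by
    intro v hv q q' h1 h2
    by_contra hne
    have h3 := DirectSum.decompose_of_mem_ne 𝒯 h1 hne
    rw [DirectSum.decompose_of_mem_same 𝒯 h2] at h3
    exact hv h3
  -- Nonnegative degree forces ∑ (b_i+1) e_i ≤ deg g ≤ B, which leaves only finitely many exponents.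
  have hexp : ∀ b, ∀ g ∈ E, ∀ m : ℚ, 0 ≤ m → V b g ∈ 𝒯 m → V b g ≠ 0 → ∀ i, b i < B := by
    intro b g hg m hm hVm hne i
    have h1 := huniq _ hne _ _ hVm (hVdeg b g hg)
    have h2 : ((b i : ℚ) + 1) * e i ≤ ∑ i, ((b i : ℚ) + 1) * e i :=
      Finset.single_le_sum (f := fun i => ((b i : ℚ) + 1) * e i)
        (fun j _ => by positivity) (Finset.mem_univ i)
    have h3 : ((b i : ℚ) + 1) * 1 ≤ ((b i : ℚ) + 1) * e i := by
      gcongr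
      exact_mod_cast he i
    have h4 : (δ g : ℚ) ≤ B := by exact_mod_cast hB g hg
    have h5 : (b i : ℚ) + 1 ≤ B := by linarith
    have h6 : b i + 1 ≤ B := by exact_mod_cast h5
    omega
  let F : Finset T := (E ×ˢ Fintype.piFinset fun _ : Fin d => Finset.range B).image
    fun a => V a.2 a.1
  -- In t^b g/(∏ t)^N, either some b_i ≥ N and t_i leaves the denominator, or the fraction is a V
  -- with exponents N - b_i - 1.
  have hmemspan : ∀ N : ℕ, ∀ r : R, (∏ i, u i) ^ N * algebraMap R T r ∈
      (faceSum M t).restrictScalars K ⊔ Submodule.span K {v | ∃ b, ∃ g ∈ E, v = V b g} := by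
    intro N r
    have hr : r ∈ monomialSpan K t (E : Set R) := hEtop ▸ trivial
    induction hr using Submodule.span_induction with
    | mem r hr =>
      obtain ⟨b, g, hg, rfl⟩ := hr
      by_cases hb : ∃ i, N ≤ b i
      · obtain ⟨i, hi⟩ := hb
        refine Submodule.mem_sup_left ?_
        refine (le_iSup (fun i => locIn M t (Finset.univ.erase i)) i) ?_
        refine ⟨N, Algebra.mem_bot.2
          ⟨t i ^ (b i - N) * (∏ j ∈ Finset.univ.erase i, t j ^ b j) * g, ?_⟩⟩
        rw [Algebra.smul_def, ← Finset.mul_prod_erase _ u (Finset.mem_univ i),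
          ← Finset.mul_prod_erase _ (fun i => t i ^ b i) (Finset.mem_univ i)]
        have h1 : algebraMap R T (∏ j ∈ Finset.univ.erase i, t j) *
            ∏ j ∈ Finset.univ.erase i, u j = 1 := by
          rw [map_prod, ← Finset.prod_mul_distrib, Finset.prod_eq_one]
          exact fun j _ => hu' j
        obtain ⟨k, hk⟩ := Nat.exists_eq_add_of_le hi
        rw [hk, Nat.add_sub_cancel_left, pow_add]
        simp only [map_mul, map_pow]
        have h2 := hu' i
        set A := algebraMap R T (∏ j ∈ Finset.univ.erase i, t j)
        set A' := ∏ j ∈ Finset.univ.erase i, u j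
        calc _ = (A * A') ^ N * (algebraMap R T (t i) * u i) ^ N *
              (algebraMap R T (t i) ^ k *
                algebraMap R T (∏ j ∈ Finset.univ.erase i, t j ^ b j) * algebraMap R T g) := by
              rw [h1, h2]; simp
          _ = _ := by ring
      · push Not at hb
        refine Submodule.mem_sup_right (Submodule.subset_span ⟨fun i => N - b i - 1, g, hg, ?_⟩)
        simp only [V]
        rw [map_mul, ← mul_assoc, ← Finset.prod_pow, map_prod, ← Finset.prod_mul_distrib]
        congr 1
        refine Finset.prod_congr rfl fun i _ => ?_
        have h1 : N = (N - b i - 1 + 1) + b i := by have := hb i; omega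
        conv_lhs => rw [h1]
        rw [pow_add, map_pow, mul_assoc, ← mul_pow, mul_comm (u i) (algebraMap R T (t i)), hu',
          one_pow, mul_one]
    | zero => simp
    | add a b _ _ ha hb => rw [map_add, mul_add]; exact add_mem ha hb
    | smul c a _ ha =>
      rw [Algebra.algebraMap_eq_smul_one, smul_assoc, ← Algebra.algebraMap_eq_smul_one,
        mul_smul_comm]
      exact Submodule.smul_mem _ _ ha
  refine ⟨B, F, ?_, ?_, ?_⟩
  · intro v hv
    obtain ⟨a, _, rfl⟩ := Finset.mem_image.1 hv
    exact hVloc _ _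
  · intro v hv q hq hne
    obtain ⟨a, ha, rfl⟩ := Finset.mem_image.1 hv
    have hg := (Finset.mem_product.1 ha).1
    rw [huniq _ hne _ _ hq (hVdeg a.2 a.1 hg)]
    have h4 : (δ a.1 : ℚ) ≤ B := by exact_mod_cast hB _ hg
    have : 0 ≤ ∑ i, ((a.2 i : ℚ) + 1) * e i := Finset.sum_nonneg fun i _ => by positivity
    linarith
  · intro m hm w hw hwloc
    obtain ⟨N, hN⟩ := hwloc
    obtain ⟨r, hr⟩ := Algebra.mem_bot.1 hN
    have hwr : w = (∏ i, u i) ^ N * algebraMap R T r := by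
      rw [hr, Algebra.smul_def, ← mul_assoc, map_pow, ← mul_pow, map_prod,
        ← Finset.prod_mul_distrib, Finset.prod_eq_one, one_pow, one_mul]
      intro i _
      rw [mul_comm, hu']
    have hmem := hmemspan N r
    rw [← hwr] at hmem
    obtain ⟨x, hx, y, hy, hxy⟩ := Submodule.mem_sup.1 hmem
    rw [← DirectSum.decompose_of_mem_same 𝒯 hw, ← hxy, DirectSum.decompose_add,
      DirectSum.add_apply, AddMemClass.coe_add]
    refine add_mem (Submodule.mem_sup_left ?_) (Submodule.mem_sup_right ?_)
    · obtain ⟨β, hβ, hsum⟩ := decompose_mem_faceSum (q := m) hM (fun i => hmap _ _ (ht i)) hx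
      rw [← hsum]
      exact mem_faceSum.2 ⟨β, fun i => (hβ i).1, rfl⟩
    · clear hxy
      induction hy using Submodule.span_induction with
      | mem v hv =>
        obtain ⟨b, g, hg, rfl⟩ := hv
        by_cases hVm : V b g ∈ 𝒯 m
        · rw [DirectSum.decompose_of_mem_same 𝒯 hVm]
          by_cases hne : V b g = 0
          · rw [hne]; exact zero_mem _
          refine Submodule.subset_span ⟨Finset.mem_image.2 ⟨(g, b), ?_, rfl⟩, hVm, hne⟩
          refine Finset.mem_product.2 ⟨hg, Fintype.mem_piFinset.2 fun i => Finset.mem_range.2 ?_⟩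
          exact hexp b g hg m hm hVm hne i
        · have hdeg := hVdeg b g hg
          rw [DirectSum.decompose_of_mem_ne 𝒯 hdeg]
          · exact zero_mem _
          · rintro rfl
            exact hVm hdeg
      | zero => simp
      | add a b _ _ ha hb =>
        rw [DirectSum.decompose_add, DirectSum.add_apply, AddMemClass.coe_add]
        exact add_mem ha hb
      | smul c a _ ha =>
        rw [decompose_smul_of_host h0 hmap]
        exact Submodule.smul_mem _ _ ha

/-- Every class of nonnegative degree satisfies an additive equation over `K`. -/
theorem exists_frobPoly_mem_faceSum {p : ℕ} [ExpChar T p] (hp : 1 < p) {d : ℕ} {t : Fin d → R}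
    {B : ℕ} {F : Finset T} (hFdeg : ∀ v ∈ F, ∀ q, v ∈ 𝒯 q → v ≠ 0 → q ≤ B)
    (hF : ∀ (m : ℚ), 0 ≤ m → ∀ w ∈ 𝒯 m,
        w ∈ locIn (Subalgebra.toSubmodule (⊥ : Subalgebra R T)) t Finset.univ →
        w ∈ (faceSum (Subalgebra.toSubmodule (⊥ : Subalgebra R T)) t).restrictScalars K ⊔
          Submodule.span K {v | v ∈ F ∧ v ∈ 𝒯 m ∧ v ≠ 0})
    {m : ℚ} (hm : 0 ≤ m) {α : T} (hα : α ∈ 𝒯 m)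
    (hαloc : α ∈ locIn (Subalgebra.toSubmodule (⊥ : Subalgebra R T)) t Finset.univ) :
    ∃ (e : ℕ) (c : ℕ → K), (m = 0 ∨ ∀ i, c i = 0) ∧
      frobPoly K p e c α ∈ faceSum (Subalgebra.toSubmodule (⊥ : Subalgebra R T)) t := by
  set P := (faceSum (Subalgebra.toSubmodule (⊥ : Subalgebra R T)) t).restrictScalars K with hP
  rcases hm.eq_or_lt with rfl | hpos
  -- In degree 0 all α^(p^n) stay in degree 0, hence in the finite-dimensional W modulo faces. The
  -- chain spanned by the first n of them stabilizes, which gives a dependence with leading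
  -- coefficient 1.
  · let W : Submodule K (T ⧸ P) := Submodule.span K (P.mkQ '' F)
    have hfin : FiniteDimensional K W :=
      FiniteDimensional.span_of_finite K (F.finite_toSet.image _)
    have hmemW : ∀ n : ℕ, P.mkQ (α ^ p ^ n) ∈ W := by
      intro n
      have hdeg : α ^ p ^ n ∈ 𝒯 0 := by
        have := SetLike.pow_mem_graded (p ^ n) hα
        rwa [smul_zero] at this
      obtain ⟨x, hx, y, hy, hxy⟩ := Submodule.mem_sup.1
        (hF 0 le_rfl _ hdeg (pow_mem_locIn hαloc _))
      have hx0 : P.mkQ x = 0 := (Submodule.Quotient.mk_eq_zero P).2 hx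
      rw [← hxy, map_add, hx0, zero_add]
      have h1 : P.mkQ y ∈ (Submodule.span K {v | v ∈ F ∧ v ∈ 𝒯 0 ∧ v ≠ 0}).map P.mkQ := ⟨y, hy, rfl⟩
      rw [Submodule.map_span] at h1
      exact Submodule.span_mono (Set.image_mono fun v hv => hv.1) h1
    let v : ℕ → W := fun n => ⟨P.mkQ (α ^ p ^ n), hmemW n⟩
    let f : ℕ →o Submodule K W :=
      ⟨fun n => Submodule.span K (v '' (Finset.range n : Set ℕ)), fun a b hab =>
        Submodule.span_mono (Set.image_mono (by simpa using hab))⟩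
    obtain ⟨n, hn⟩ := monotone_stabilizes_iff_noetherian.2 (inferInstance : IsNoetherian K W) f
    have hvn : v n ∈ f n := by
      rw [hn (n + 1) n.le_succ]
      exact Submodule.subset_span ⟨n, by simp, rfl⟩
    obtain ⟨c, hc⟩ : ∃ c : ℕ → K, ∑ i ∈ Finset.range n, c i • v i = v n := by
      obtain ⟨c, hc⟩ := (Submodule.mem_span_image_finset_iff_exists_fun K).1 hvn
      refine ⟨fun i => if h : i ∈ Finset.range n then c ⟨i, h⟩ else 0, ?_⟩
      rw [← hc, ← Finset.sum_coe_sort]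
      exact Finset.sum_congr rfl fun i _ => by beta_reduce; rw [dif_pos i.2]
    refine ⟨n, fun i => -c i, Or.inl rfl, ?_⟩
    have h1 : P.mkQ (frobPoly K p n (fun i => -c i) α) = 0 := by
      rw [frobPoly_apply, map_add, map_sum]
      have h2 := congrArg Subtype.val hc
      simp only [AddSubmonoidClass.coe_finsetSum, Submodule.coe_smul, v] at h2
      rw [← h2, ← Finset.sum_add_distrib, Finset.sum_eq_zero]
      intro i _
      rw [map_smul, neg_smul, add_neg_cancel]
    exact (Submodule.Quotient.mk_eq_zero P).1 h1
  -- In positive degree Frobenius pushes α beyond the bound B, where no generators remain.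
  · obtain ⟨e, he⟩ : ∃ e : ℕ, (B : ℚ) < (p ^ e : ℕ) * m := by
      obtain ⟨N, hN⟩ := exists_nat_gt ((B : ℚ) / m)
      refine ⟨N, (div_lt_iff₀ hpos).1 (hN.trans_le ?_)⟩
      exact_mod_cast (Nat.lt_pow_self hp).le
    refine ⟨e, 0, Or.inr fun _ => rfl, ?_⟩
    rw [frobPoly_apply]
    simp only [Pi.zero_apply, zero_smul, Finset.sum_const_zero, add_zero]
    have hdeg : α ^ p ^ e ∈ 𝒯 ((p ^ e : ℕ) * m) := by
      have := SetLike.pow_mem_graded (p ^ e) hα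
      rwa [nsmul_eq_mul] at this
    have h1 := hF _ (by positivity) _ hdeg (pow_mem_locIn hαloc _)
    have h2 : {v | v ∈ F ∧ v ∈ 𝒯 ((p ^ e : ℕ) * m) ∧ v ≠ 0} = ∅ := by
      rw [Set.eq_empty_iff_forall_notMem]
      rintro v ⟨hv, hvm, hv0⟩
      exact absurd (hFdeg v hv _ hvm hv0) (not_le.2 he)
    rw [h2, Submodule.span_empty, sup_bot_eq] at h1
    exact h1

/-- The equational lemma: a class satisfying an additive equation over `K` dies in every subalgebra
containing suitable homogeneous integral elements. -/
theorem exists_finset_mem_faceSum [GradedAlgebra 𝒜] (h0 : 𝒜 0 = 1) {p : ℕ} [ExpChar T p]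
    (hp : 1 < p) (hH : IsHost 𝒜 𝒯 p) {d : ℕ} (hd : 0 < d) {t : Fin d → R} {δ : Fin d → ℕ}
    (ht : ∀ i, t i ∈ 𝒜 (δ i)) {m : ℚ} (hm : 0 ≤ m) {α : T} (hα : α ∈ 𝒯 m)
    {e : ℕ} {c : ℕ → K} (hc : m = 0 ∨ ∀ i, c i = 0)
    (hfrob : frobPoly K p e c α ∈ faceSum (Subalgebra.toSubmodule (⊥ : Subalgebra R T)) t) :
    ∃ H : Finset T, (∀ h ∈ H, IsIntegral R h ∧ ∃ q : ℚ, 0 ≤ q ∧ h ∈ 𝒯 q) ∧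
      ∀ S : Subalgebra R T, (H : Set T) ⊆ S → α ∈ faceSum (Subalgebra.toSubmodule S) t := by
  classical
  have hM := decompose_mem_bot (𝒯 := 𝒯) (T := T) hH.algebraMap_mem
  have hdeg : frobPoly K p e c α ∈ 𝒯 ((p ^ e : ℕ) * m) := by
    rw [frobPoly_apply]
    have h1 : ∀ n : ℕ, α ^ p ^ n ∈ 𝒯 ((p ^ n : ℕ) * m) := fun n => by
      have := SetLike.pow_mem_graded (p ^ n) hα
      rwa [nsmul_eq_mul] at this
    refine add_mem (h1 e) (sum_mem fun i _ => ?_)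
    rcases hc with rfl | hc
    · have := SetLike.mul_mem_graded (algebraMap_mem_zero h0 hH.algebraMap_mem (c i)) (h1 i)
      rwa [mul_zero, zero_add, ← mul_zero ((p ^ e : ℕ) : ℚ), ← Algebra.smul_def] at this
    · rw [hc, zero_smul]; exact zero_mem _
  obtain ⟨β, hβ, hsum⟩ := decompose_mem_faceSum (q := (p ^ e : ℕ) * m) hM
    (fun i => hH.algebraMap_mem _ _ (ht i)) hfrob
  rw [DirectSum.decompose_of_mem_same 𝒯 hdeg] at hsum
  choose y hym hy using fun i => hH.exists_root m e c hc (β i) (hβ i).2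
  choose N hN using fun i => (hβ i).1
  choose r hr using fun i => Algebra.mem_bot.1 (hN i)
  -- The denominator of β_i, so that a_i β_i = r_i comes from R.
  let a : Fin d → R := fun i => (∏ j ∈ Finset.univ.erase i, t j) ^ N i
  set γ := α - ∑ i, y i with hγ
  have hγm : γ ∈ 𝒯 m := sub_mem hα (sum_mem fun i _ => hym i)
  have hγ0 : frobPoly K p e c γ = 0 := by
    rw [hγ, map_sub, map_sum, ← hsum]
    simp [hy]
  have htower : ∀ x : K, ∀ w : T, x • w = algebraMap R T (algebraMap K R x) * w := fun x w => by
    rw [← IsScalarTower.algebraMap_apply, Algebra.smul_def]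
  refine ⟨insert γ (Finset.univ.image fun i => a i • y i), ?_, ?_⟩
  · intro h hh
    rcases Finset.mem_insert.1 hh with rfl | hh
    · refine ⟨isIntegral_of_pow_add_sum_eq hp e (fun i => algebraMap K R (c i)) (r := 0) ?_,
        m, hm, hγm⟩
      rw [map_zero, ← hγ0, frobPoly_apply]
      simp only [htower]
    · obtain ⟨i, _, rfl⟩ := Finset.mem_image.1 hh
      refine ⟨?_, N i • (∑ j ∈ Finset.univ.erase i, (δ j : ℚ)) + m, by positivity, ?_⟩
      -- Multiply Φ(y_i) = β_i by a_i^(p^e): the term of exponent p^k keeps a factor a_i^(p^e -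
      -- p^k), and the right side becomes a_i^(p^e - 1) r_i.
      · refine isIntegral_of_pow_add_sum_eq hp e
          (fun k => algebraMap K R (c k) * a i ^ (p ^ e - p ^ k))
          (r := a i ^ (p ^ e - 1) * r i) ?_
        rw [map_mul, hr i, ← hy i, frobPoly_apply]
        simp only [htower, Algebra.smul_def (a i), Algebra.smul_def (_ ^ N i)]
        have h1 : algebraMap R T (a i ^ (p ^ e - 1)) *
            algebraMap R T ((∏ j ∈ Finset.univ.erase i, t j) ^ N i) =
            algebraMap R T (a i) ^ p ^ e := by
          rw [← map_mul, ← map_pow]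
          congr 1
          change a i ^ (p ^ e - 1) * a i = a i ^ p ^ e
          rw [← pow_succ, Nat.sub_add_cancel (Nat.pow_pos (by omega))]
        rw [← mul_assoc, h1, mul_add, mul_pow, Finset.mul_sum]
        congr 1
        refine Finset.sum_congr rfl fun k hk => ?_
        have h2 : p ^ e = (p ^ e - p ^ k) + p ^ k :=
          (Nat.sub_add_cancel (Nat.pow_le_pow_right (by omega) (Finset.mem_range.1 hk).le)).symm
        conv_rhs => rw [h2, pow_add]
        rw [map_mul, map_pow, mul_pow]
        ring
      · rw [Algebra.smul_def (a i)]
        refine SetLike.mul_mem_graded ?_ (hym i)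
        rw [map_pow, map_prod]
        exact SetLike.pow_mem_graded _ (SetLike.prod_mem_graded _ _ _
          fun j _ => hH.algebraMap_mem _ _ (ht j))
  · intro S hS
    have hα' : α = γ + ∑ i, y i := by rw [hγ, sub_add_cancel]
    rw [hα']
    refine add_mem ?_ (sum_mem fun i _ => ?_)
    -- γ needs no denominator, so any face contains it; d > 0 guarantees that a face exists.
    · exact (le_iSup (fun i => locIn (Subalgebra.toSubmodule S) t (Finset.univ.erase i)) ⟨0, hd⟩)
        (le_locIn _ (hS (Finset.mem_insert_self _ _)))
    · refine (le_iSup (fun i => locIn (Subalgebra.toSubmodule S) t (Finset.univ.erase i)) i) ?_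
      exact ⟨N i, hS (Finset.mem_insert_of_mem (Finset.mem_image.2 ⟨i, Finset.mem_univ i, rfl⟩))⟩

/-- The equational lemma is needed only for the finite generating set F. The union of the resulting
finite sets handles every class of every nonnegative degree, since the face sum over S is a
K-subspace. -/
theorem exists_finset_forall_mem_faceSum [GradedAlgebra 𝒜] (h0 : 𝒜 0 = 1) {p : ℕ} [ExpChar T p]
    (hp : 1 < p) (hH : IsHost 𝒜 𝒯 p) {d : ℕ} (hd : 0 < d) {t : Fin d → R} {δ : Fin d → ℕ}
    (ht : ∀ i, 0 < δ i ∧ t i ∈ 𝒜 (δ i) ∧ t i ≠ 0)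
    {E : Finset R} (hE : ∀ g ∈ E, SetLike.IsHomogeneousElem 𝒜 g)
    (hEtop : monomialSpan K t (E : Set R) = ⊤) :
    ∃ H : Finset T, (∀ h ∈ H, IsIntegral R h ∧ ∃ q : ℚ, 0 ≤ q ∧ h ∈ 𝒯 q) ∧
      ∀ S : Subalgebra R T, (H : Set T) ⊆ S → ∀ m : ℚ, 0 ≤ m → ∀ α ∈ 𝒯 m,
        α ∈ locIn (Subalgebra.toSubmodule (⊥ : Subalgebra R T)) t Finset.univ →
        α ∈ faceSum (Subalgebra.toSubmodule S) t := by
  classical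
  obtain ⟨B, F, hFloc, hFdeg, hF⟩ := exists_finset_span h0 hH.algebraMap_mem
    (fun i => (ht i).2.1) (fun i => (ht i).1)
    (fun i => hH.isUnit_algebraMap _ _ (ht i).2.1 (ht i).2.2) hE hEtop
  have key : ∀ v : T, ∃ H : Finset T, (∀ h ∈ H, IsIntegral R h ∧ ∃ q : ℚ, 0 ≤ q ∧ h ∈ 𝒯 q) ∧
      (v ∈ F → (∃ q : ℚ, 0 ≤ q ∧ v ∈ 𝒯 q) → ∀ S : Subalgebra R T, (H : Set T) ⊆ S →
        v ∈ faceSum (Subalgebra.toSubmodule S) t) := by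
    intro v
    by_cases hv : v ∈ F ∧ ∃ q : ℚ, 0 ≤ q ∧ v ∈ 𝒯 q
    · obtain ⟨hvF, q, hq, hvq⟩ := hv
      obtain ⟨e, c, hc, hfrob⟩ := exists_frobPoly_mem_faceSum hp hFdeg hF hq hvq (hFloc v hvF)
      obtain ⟨H, hH1, hH2⟩ := exists_finset_mem_faceSum h0 hp hH hd (fun i => (ht i).2.1) hq hvq
        hc hfrob
      exact ⟨H, hH1, fun _ _ => hH2⟩
    · exact ⟨∅, by simp, fun h1 h2 => absurd ⟨h1, h2⟩ hv⟩
  choose H hH1 hH2 using key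
  refine ⟨F.biUnion H, ?_, ?_⟩
  · intro h hh
    obtain ⟨v, _, hv⟩ := Finset.mem_biUnion.1 hh
    exact hH1 v h hv
  · intro S hS m hm α hα hαloc
    have hle : faceSum (Subalgebra.toSubmodule (⊥ : Subalgebra R T)) t ≤
        faceSum (Subalgebra.toSubmodule S) t :=
      iSup_mono fun i => locIn_mono (Subalgebra.toSubmodule.monotone bot_le) _
    have h1 : (faceSum (Subalgebra.toSubmodule (⊥ : Subalgebra R T)) t).restrictScalars K ⊔
          Submodule.span K {v | v ∈ F ∧ v ∈ 𝒯 m ∧ v ≠ 0} ≤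
        (faceSum (Subalgebra.toSubmodule S) t).restrictScalars K := by
      refine sup_le (fun _ h => hle h) (Submodule.span_le.2 ?_)
      rintro v ⟨hv, hvm, _⟩
      refine hH2 v hv ⟨m, hm, hvm⟩ S fun x hx => hS ?_
      exact Finset.mem_biUnion.2 ⟨v, hv, hx⟩
    exact h1 (hF m hm α hα hαloc)

end Host

end GradedLC

namespace GradedLC

/-! ### Graded subalgebras -/

section GradedSubalgebra

variable {R : Type u} {T : Type w} [CommRing R] [CommRing T] [Algebra R T] {σ : Type*}
  [SetLike σ T] [AddSubgroupClass σ T]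

/-- The homogeneous parts of a subalgebra. -/
def gradedPart (𝒯 : ℚ → σ) (S : Subalgebra R T) (q : ℚ) : AddSubgroup S where
  carrier := {s | (s : T) ∈ 𝒯 q}
  zero_mem' := zero_mem (𝒯 q)
  add_mem' := fun ha hb => add_mem (S := σ) ha hb
  neg_mem' := fun ha => neg_mem (S := σ) ha

variable (𝒯 : ℚ → σ) [GradedRing 𝒯] {S : Subalgebra R T}

theorem coe_gradedPart_apply (x : DirectSum ℚ fun q => gradedPart 𝒯 S q) (q : ℚ) :
    ((x q : S) : T) =
      DirectSum.decompose 𝒯 ((DirectSum.coeAddMonoidHom (gradedPart 𝒯 S) x : S) : T) q := by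
  induction x using DirectSum.induction_on with
  | zero => simp
  | of j y =>
    rw [DirectSum.coeAddMonoidHom_of]
    by_cases h : j = q
    · subst h
      rw [DirectSum.of_eq_same, DirectSum.decompose_of_mem_same 𝒯 y.2]
    · rw [DirectSum.of_eq_of_ne _ _ _ (Ne.symm h), DirectSum.decompose_of_mem_ne 𝒯 y.2 h]
      simp
  | add a b ha hb =>
    rw [DirectSum.add_apply, AddMemClass.coe_add, map_add, Subalgebra.coe_add, ha, hb,
      Subalgebra.coe_add, DirectSum.decompose_add, DirectSum.add_apply, AddMemClass.coe_add]

theorem isInternal_gradedPart (hS : ∀ v ∈ S, ∀ q, (DirectSum.decompose 𝒯 v q : T) ∈ S) :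
    DirectSum.IsInternal (gradedPart 𝒯 S) := by
  classical
  constructor
  · rw [injective_iff_map_eq_zero]
    intro x hx
    ext q
    rw [coe_gradedPart_apply, hx]
    simp
  · intro s
    refine ⟨∑ q ∈ (DirectSum.decompose 𝒯 (s : T)).support,
      DirectSum.of (fun q => gradedPart 𝒯 S q) q
        ⟨⟨DirectSum.decompose 𝒯 (s : T) q, hS s s.2 q⟩, SetLike.coe_mem _⟩, ?_⟩
    rw [map_sum]
    simp only [DirectSum.coeAddMonoidHom_of]
    apply Subtype.ext
    rw [AddSubmonoidClass.coe_finsetSum]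
    exact DirectSum.sum_support_decompose 𝒯 (s : T)

/-- A subalgebra that contains the homogeneous components of its elements is graded. -/
@[reducible]
noncomputable def gradedRingGradedPart (hS : ∀ v ∈ S, ∀ q, (DirectSum.decompose 𝒯 v q : T) ∈ S) :
    GradedRing (gradedPart 𝒯 S) where
  one_mem := SetLike.GradedOne.one_mem (A := 𝒯)
  mul_mem _ _ _ _ ha hb := SetLike.GradedMul.mul_mem (A := 𝒯) ha hb
  toDecomposition := (isInternal_gradedPart 𝒯 hS).chooseDecomposition

variable {𝒯}

/-- For a product, expand both factors into components: each product of components is a homogeneous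
element of the adjoined algebra, so its components are itself and zero. -/
theorem decompose_mem_adjoin {H : Set T} (hH : ∀ h ∈ H, ∃ q, h ∈ 𝒯 q)
    (hR : ∀ r : R, ∀ q, (DirectSum.decompose 𝒯 (algebraMap R T r) q : T) ∈
      (⊥ : Subalgebra R T)) :
    ∀ v ∈ Algebra.adjoin R H, ∀ q, (DirectSum.decompose 𝒯 v q : T) ∈ Algebra.adjoin R H := by
  classical
  have hhom : ∀ v ∈ Algebra.adjoin R H, ∀ j, v ∈ 𝒯 j → ∀ q,
      (DirectSum.decompose 𝒯 v q : T) ∈ Algebra.adjoin R H := by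
    intro v hv j hj q
    by_cases h : j = q
    · subst h
      rwa [DirectSum.decompose_of_mem_same 𝒯 hj]
    · rw [DirectSum.decompose_of_mem_ne 𝒯 hj h]
      exact zero_mem _
  intro v hv
  induction hv using Algebra.adjoin_induction with
  | mem h hh =>
    obtain ⟨j, hj⟩ := hH h hh
    exact hhom h (Algebra.subset_adjoin hh) j hj
  | algebraMap r => exact fun q => (bot_le : (⊥ : Subalgebra R T) ≤ _) (hR r q)
  | add a b _ _ ha hb =>
    intro q
    rw [DirectSum.decompose_add, DirectSum.add_apply, AddMemClass.coe_add]
    exact add_mem (ha q) (hb q)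
  | mul a b _ _ ha hb =>
    intro q
    rw [← DirectSum.sum_support_decompose 𝒯 a, ← DirectSum.sum_support_decompose 𝒯 b,
      Finset.sum_mul_sum, DirectSum.decompose_sum, DFinsupp.finsetSum_apply,
      AddSubmonoidClass.coe_finsetSum]
    refine sum_mem fun i _ => ?_
    rw [DirectSum.decompose_sum, DFinsupp.finsetSum_apply, AddSubmonoidClass.coe_finsetSum]
    exact sum_mem fun j _ => hhom _ (mul_mem (ha i) (hb j)) _
      (SetLike.mul_mem_graded (SetLike.coe_mem _) (SetLike.coe_mem _)) q

end GradedSubalgebra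

/-! ### The group algebra of `ℚ` over the algebraic closure -/

section HostAlgebra

variable {K : Type v} {R : Type u} [Field K] [CommRing R] [IsDomain R] [Algebra K R]

/-- The group algebra `Ω[ℚ]` over the algebraic closure `Ω` of `frac R`, seen as an extension of
the graded ring `R` by sending `r ∈ R_i` to `r u^i`. -/
def Host (_𝒜 : ℕ → Submodule K R) : Type u :=
  AddMonoidAlgebra (AlgebraicClosure (FractionRing R)) ℚ

variable (𝒜 : ℕ → Submodule K R)

noncomputable instance : CommRing (Host 𝒜) :=
  inferInstanceAs (CommRing (AddMonoidAlgebra (AlgebraicClosure (FractionRing R)) ℚ))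

/-- Because ℚ is an ordered group, leading terms multiply without cancelling. The ring S inherits
this as a subring. -/
instance : IsDomain (Host 𝒜) :=
  inferInstanceAs (IsDomain (AddMonoidAlgebra (AlgebraicClosure (FractionRing R)) ℚ))

noncomputable instance : Algebra (AlgebraicClosure (FractionRing R)) (Host 𝒜) :=
  inferInstanceAs (Algebra (AlgebraicClosure (FractionRing R))
    (AddMonoidAlgebra (AlgebraicClosure (FractionRing R)) ℚ))

namespace Host

/-- The monomial `a u^q`. -/
noncomputable def mono (q : ℚ) : AlgebraicClosure (FractionRing R) →+ Host 𝒜 :=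
  AddMonoidAlgebra.singleAddHom q

/-- The grading of `Ω[ℚ]` by exponents. -/
noncomputable def grade (q : ℚ) : Submodule (AlgebraicClosure (FractionRing R)) (Host 𝒜) :=
  AddMonoidAlgebra.grade (AlgebraicClosure (FractionRing R)) q

noncomputable instance : GradedAlgebra (grade 𝒜) :=
  inferInstanceAs (GradedAlgebra (AddMonoidAlgebra.grade (AlgebraicClosure (FractionRing R)) :
    ℚ → Submodule _ (AddMonoidAlgebra (AlgebraicClosure (FractionRing R)) ℚ)))

/-- Evaluation at `u = 1`. -/
noncomputable def eval : Host 𝒜 →ₐ[AlgebraicClosure (FractionRing R)]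
    AlgebraicClosure (FractionRing R) :=
  AddMonoidAlgebra.lift _ _ ℚ 1

variable {𝒜}

theorem mono_mul (q q' : ℚ) (a b : AlgebraicClosure (FractionRing R)) :
    mono 𝒜 q a * mono 𝒜 q' b = mono 𝒜 (q + q') (a * b) :=
  AddMonoidAlgebra.single_mul_single _ _ _ _

theorem mono_pow (q : ℚ) (a : AlgebraicClosure (FractionRing R)) (n : ℕ) :
    mono 𝒜 q a ^ n = mono 𝒜 (n * q) (a ^ n) := by
  rw [← nsmul_eq_mul]
  exact AddMonoidAlgebra.single_pow _ _ _

theorem mono_zero_one : mono 𝒜 0 1 = 1 := rfl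

theorem mem_grade {q : ℚ} {w : Host 𝒜} : w ∈ grade 𝒜 q ↔ ∃ a, w = mono 𝒜 q a := by
  have h : w ∈ grade 𝒜 q ↔ w ∈ LinearMap.range
      (AddMonoidAlgebra.lsingle (R := AlgebraicClosure (FractionRing R))
        (S := AlgebraicClosure (FractionRing R)) q) := by
    rw [← AddMonoidAlgebra.grade_eq_lsingle_range]; rfl
  rw [h]
  exact ⟨fun ⟨a, ha⟩ => ⟨a, ha.symm⟩, fun ⟨a, ha⟩ => ⟨a, ha.symm⟩⟩

theorem mono_mem_grade (q : ℚ) (a : AlgebraicClosure (FractionRing R)) :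
    mono 𝒜 q a ∈ grade 𝒜 q := mem_grade.2 ⟨a, rfl⟩

theorem eval_mono (q : ℚ) (a : AlgebraicClosure (FractionRing R)) :
    eval 𝒜 (mono 𝒜 q a) = a := by
  have : eval 𝒜 (mono 𝒜 q a) = a • (1 : AlgebraicClosure (FractionRing R)) :=
    AddMonoidAlgebra.lift_single _ _ _
  rw [this, smul_eq_mul, mul_one]

variable [GradedAlgebra 𝒜]

variable (𝒜) in
/-- The embedding `R → Ω[ℚ]`. -/
noncomputable def ofGraded : R →+* Host 𝒜 :=
  (DirectSum.toSemiring
    (fun i : ℕ => ((mono 𝒜 (i : ℚ)).comp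
      (algebraMap R (AlgebraicClosure (FractionRing R))).toAddMonoidHom).comp
        (𝒜 i).subtype.toAddMonoidHom)
    (by
      change mono 𝒜 ((0 : ℕ) : ℚ) (algebraMap R _ 1) = 1
      rw [map_one, Nat.cast_zero]; rfl)
    (by
      intro i j a b
      change mono 𝒜 ((i + j : ℕ) : ℚ) (algebraMap R _ ((a : R) * b)) =
        mono 𝒜 i (algebraMap R _ a) * mono 𝒜 j (algebraMap R _ b)
      rw [mono_mul, map_mul, Nat.cast_add])).comp
    (DirectSum.decomposeRingEquiv 𝒜 : R →+* _)

theorem ofGraded_of_mem {i : ℕ} {r : R} (hr : r ∈ 𝒜 i) :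
    ofGraded 𝒜 r = mono 𝒜 i (algebraMap R _ r) := by
  have h1 : DirectSum.decomposeRingEquiv 𝒜 r = DirectSum.of (fun i => 𝒜 i) i ⟨r, hr⟩ :=
    DirectSum.decompose_of_mem 𝒜 hr
  simp only [ofGraded, RingHom.comp_apply, RingHom.coe_coe]
  rw [h1, DirectSum.toSemiring_of]
  rfl

noncomputable instance : Algebra R (Host 𝒜) := (ofGraded 𝒜).toAlgebra

noncomputable instance : Algebra K (Host 𝒜) := ((ofGraded 𝒜).comp (algebraMap K R)).toAlgebra

instance : IsScalarTower K R (Host 𝒜) := IsScalarTower.of_algebraMap_eq fun _ => rfl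

theorem algebraMap_of_mem {i : ℕ} {r : R} (hr : r ∈ 𝒜 i) :
    algebraMap R (Host 𝒜) r = mono 𝒜 i (algebraMap R _ r) := ofGraded_of_mem hr

theorem eval_algebraMap (r : R) :
    eval 𝒜 (algebraMap R (Host 𝒜) r) = algebraMap R (AlgebraicClosure (FractionRing R)) r := by
  classical
  rw [← DirectSum.sum_support_decompose 𝒜 r, map_sum, map_sum, map_sum]
  refine Finset.sum_congr rfl fun i _ => ?_
  rw [algebraMap_of_mem (SetLike.coe_mem _), eval_mono]

variable (𝒜) in
/-- Evaluation at `u = 1`, as a map of `R`-algebras. -/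
noncomputable def evalAlgHom : Host 𝒜 →ₐ[R] AlgebraicClosure (FractionRing R) :=
  { (eval 𝒜 : Host 𝒜 →+* AlgebraicClosure (FractionRing R)) with commutes' := eval_algebraMap }

/-- Setting u = 1 recovers the inclusion of R into Ω. -/
theorem algebraMap_injective : Function.Injective (algebraMap R (Host 𝒜)) := by
  intro a b hab
  have h1 := congrArg (eval 𝒜) hab
  rw [eval_algebraMap, eval_algebraMap] at h1
  rw [IsScalarTower.algebraMap_apply R (FractionRing R),
    IsScalarTower.algebraMap_apply R (FractionRing R)] at h1
  exact IsFractionRing.injective R (FractionRing R) ((algebraMap (FractionRing R) _).injective h1)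

/-- Each graded piece is a line Ω u^q. Thus nonzero homogeneous elements are invertible, and a
homogeneous additive equation for y u^m is one polynomial equation of degree p^e over the
algebraically closed field Ω. -/
theorem isHost (h0 : 𝒜 0 = 1) {p : ℕ} [ExpChar (Host 𝒜) p] (hp : 1 < p) :
    IsHost 𝒜 (grade 𝒜) p where
  algebraMap_mem i r hr := by
    rw [algebraMap_of_mem hr]; exact mono_mem_grade _ _
  isUnit_algebraMap i r hr hne := by
    have hne' : algebraMap R (AlgebraicClosure (FractionRing R)) r ≠ 0 := by
      rw [← eval_algebraMap (𝒜 := 𝒜), algebraMap_of_mem hr, eval_mono]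
      rw [IsScalarTower.algebraMap_apply R (FractionRing R)]
      intro h
      rw [map_eq_zero] at h
      exact hne ((map_eq_zero_iff _ (IsFractionRing.injective R (FractionRing R))).1 h)
    rw [algebraMap_of_mem hr]
    refine IsUnit.of_mul_eq_one (mono 𝒜 (-i) (algebraMap R _ r)⁻¹) ?_
    rw [mono_mul, mul_inv_cancel₀ hne', add_neg_cancel, mono_zero_one]
  exists_root m e c hc β hβ := by
    obtain ⟨b, rfl⟩ := mem_grade.1 hβ
    let κ : K → AlgebraicClosure (FractionRing R) := fun x => algebraMap R _ (algebraMap K R x)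
    have hsmul : ∀ (x : K) (q : ℚ) a, x • mono 𝒜 q a = mono 𝒜 q (κ x * a) := by
      intro x q a
      have hx : algebraMap K R x ∈ 𝒜 0 := by rw [h0]; exact Submodule.mem_one.2 ⟨x, rfl⟩
      rw [Algebra.smul_def, IsScalarTower.algebraMap_apply K R (Host 𝒜), algebraMap_of_mem hx,
        mono_mul, Nat.cast_zero, zero_add]
    have hdeg := degree_sum_sub_C_lt hp e (fun i => κ (c i)) b
    obtain ⟨y, hy⟩ := IsAlgClosed.exists_root
      (X ^ p ^ e + (∑ i ∈ Finset.range e, C (κ (c i)) * X ^ p ^ i - C b)) (by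
        rw [degree_add_eq_left_of_degree_lt (by rwa [degree_X_pow]), degree_X_pow]
        exact_mod_cast (Nat.pow_pos (n := e) (by omega : 0 < p)).ne')
    refine ⟨mono 𝒜 m y, mono_mem_grade _ _, ?_⟩
    have hb : b = y ^ p ^ e + ∑ i ∈ Finset.range e, κ (c i) * y ^ p ^ i := by
      simp only [IsRoot.def, eval_add, eval_sub, eval_pow, eval_X, eval_finsetSum, eval_mul,
        eval_C] at hy
      linear_combination -hy
    rw [frobPoly_apply, hb, map_add, map_sum, mono_pow]
    congr 1
    refine Finset.sum_congr rfl fun i _ => ?_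
    rw [mono_pow, hsmul]
    rcases hc with rfl | hc
    · rw [mul_zero, mul_zero]
    · have : κ (c i) = 0 := by simp [κ, hc]
      rw [this, zero_mul, map_zero, map_zero]

/-- The component of `a` of degree `s`, for a rational number `s`. -/
noncomputable def component (𝒜 : ℕ → Submodule K R) [GradedAlgebra 𝒜] (a : R) (s : ℚ) : R :=
  -- The test fails exactly when s is not a natural number, negative s included, and the component
  -- is then 0.
  DirectSum.decompose 𝒜 a ⌊s⌋₊ * if (⌊s⌋₊ : ℚ) = s then 1 else 0

theorem decompose_algebraMap (a : R) (s : ℚ) :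
    (DirectSum.decompose (grade 𝒜) (algebraMap R (Host 𝒜) a) s : Host 𝒜) =
      algebraMap R (Host 𝒜) (component 𝒜 a s) := by
  classical
  conv_lhs => rw [← DirectSum.sum_support_decompose 𝒜 a]
  rw [map_sum, DirectSum.decompose_sum, DFinsupp.finsetSum_apply, AddSubmonoidClass.coe_finsetSum]
  have hdeg : ∀ i : ℕ, algebraMap R (Host 𝒜) (DirectSum.decompose 𝒜 a i : R) ∈ grade 𝒜 (i : ℚ) :=
    fun i => by rw [algebraMap_of_mem (SetLike.coe_mem _)]; exact mono_mem_grade _ _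
  unfold component
  by_cases hs : (⌊s⌋₊ : ℚ) = s
  · rw [if_pos hs, mul_one]
    generalize ⌊s⌋₊ = n at hs
    subst hs
    rw [Finset.sum_eq_single n]
    · rw [DirectSum.decompose_of_mem_same _ (hdeg n)]
    · intro i _ hi
      rw [DirectSum.decompose_of_mem_ne _ (hdeg i) (by exact_mod_cast hi)]
    · intro hn
      have : (DirectSum.decompose 𝒜 a n : R) = 0 := by
        rw [DFinsupp.notMem_support_iff.1 hn]; rfl
      rw [this]; simp
  · rw [if_neg hs, mul_zero, map_zero]
    refine Finset.sum_eq_zero fun i _ => ?_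
    rw [DirectSum.decompose_of_mem_ne _ (hdeg i)]
    rintro rfl
    exact hs (by rw [Nat.floor_natCast])

/-- Homogeneous integral elements satisfy homogeneous equations of integral dependence. -/
theorem hasDegree_eval {h : Host 𝒜} (hint : IsIntegral R h) {q : ℚ} (hq : h ∈ grade 𝒜 q) :
    HasDegree 𝒜 q (evalAlgHom 𝒜 h) := by
  obtain ⟨P, hP, hPh⟩ := hint
  rw [← aeval_def] at hPh
  set N := P.natDegree with hN
  -- These are the coefficients of the degree Nq part of P(h) = 0, as h^k has degree kq. The leading
  -- one is the degree 0 part of 1, so the equation stays monic.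
  let cf : ℕ → R := fun k => component 𝒜 (P.coeff k) ((N - k : ℚ) * q)
  have hcfN : cf N = 1 := by
    have h1 : cf N = component 𝒜 (P.coeff N) 0 := by simp only [cf, sub_self, zero_mul]
    rw [h1, component, Nat.floor_zero, Nat.cast_zero, if_pos rfl, mul_one]
    rw [hN, hP.coeff_natDegree, DirectSum.decompose_of_mem_same 𝒜 SetLike.GradedOne.one_mem]
  have hsum : ∑ k ∈ Finset.range (N + 1), algebraMap R (Host 𝒜) (cf k) * h ^ k = 0 := by
    have h1 : (DirectSum.decompose (grade 𝒜) (aeval h P) (N * q) : Host 𝒜) = 0 := by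
      rw [hPh]; simp
    rw [aeval_eq_sum_range, DirectSum.decompose_sum, DFinsupp.finsetSum_apply,
      AddSubmonoidClass.coe_finsetSum] at h1
    rw [← h1]
    refine Finset.sum_congr rfl fun k _ => ?_
    have hk : h ^ k ∈ grade 𝒜 (k * q) := by
      have := SetLike.pow_mem_graded k hq
      rwa [nsmul_eq_mul] at this
    have h2 : (N * q : ℚ) = (N - k) * q + k * q := by ring
    rw [Algebra.smul_def, h2, DirectSum.coe_decompose_mul_add_of_right_mem _ hk,
      decompose_algebraMap]
  let Q : R[X] := X ^ N + ∑ k ∈ Finset.range N, C (cf k) * X ^ k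
  have hQdeg : (∑ k ∈ Finset.range N, C (cf k) * X ^ k).degree < (N : WithBot ℕ) := by
    refine lt_of_le_of_lt (degree_sum_le _ _) ?_
    rw [Finset.sup_lt_iff (WithBot.bot_lt_coe _)]
    intro i hi
    refine lt_of_le_of_lt (degree_C_mul_X_pow_le _ _) ?_
    exact_mod_cast Finset.mem_range.1 hi
  have hQN : Q.natDegree = N := natDegree_eq_of_degree_eq_some <| by
    rw [degree_add_eq_left_of_degree_lt (by rwa [degree_X_pow]), degree_X_pow]
  have hQh : aeval h Q = 0 := by
    simp only [Q, map_add, map_sum, map_mul, map_pow, aeval_X, aeval_C]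
    rw [← hsum, Finset.sum_range_succ, hcfN, map_one, one_mul, add_comm]
  have hcoeff : ∀ k ≤ N, Q.coeff k = cf k := by
    intro k hk
    simp only [Q, coeff_add, coeff_X_pow, finsetSum_coeff, coeff_C_mul, mul_ite, mul_one, mul_zero]
    rcases hk.eq_or_lt with rfl | hk
    · rw [if_pos rfl, hcfN, Finset.sum_eq_zero, add_zero]
      intro i hi
      rw [if_neg (Finset.mem_range.1 hi).ne']
    · rw [if_neg hk.ne, zero_add, Finset.sum_ite_eq, if_pos (Finset.mem_range.2 hk)]
  refine ⟨Q, monic_X_pow_add hQdeg, ?_, ?_⟩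
  · rw [aeval_algHom_apply, hQh, map_zero]
  · intro i hi
    rw [hQN] at hi ⊢
    rw [hcoeff _ (Nat.sub_le N i)]
    have h1 : ((N : ℚ) - ((N - i : ℕ) : ℚ)) * q = i * q := by
      rw [Nat.cast_sub hi]; ring
    have h2 : cf (N - i) = component 𝒜 (P.coeff (N - i)) (i * q) := by simp only [cf, h1]
    rw [h2]
    simp only [component]
    by_cases hs : (⌊(i * q : ℚ)⌋₊ : ℚ) = i * q
    · refine Or.inr ⟨_, hs, ?_⟩
      rw [if_pos hs, mul_one]
      exact SetLike.coe_mem _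
    · left
      rw [if_neg hs, mul_zero]

end Host

end HostAlgebra

end GradedLC

namespace GradedLC

/-! ### Čech cochains as functions with values in a graded extension -/

section Translation

variable {R : Type u} [CommRing R] {T : Type w} [CommRing T] [Algebra R T]

/-! ### Realizing localized modules inside T. -/

section LocEval

variable {M : Type w'} [AddCommGroup M] [Module R M]

theorem isUnit_end_of_mem_powers {a : R} (h : IsUnit (algebraMap R T a))
    (s : Submonoid.powers a) : IsUnit (algebraMap R (Module.End R T) s) := by
  obtain ⟨s, n, rfl⟩ := s
  rw [Module.End.isUnit_iff]
  have hu : IsUnit (algebraMap R T (a ^ n)) := by rw [map_pow]; exact h.pow n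
  have : ∀ w : T, algebraMap R (Module.End R T) (a ^ n) w = algebraMap R T (a ^ n) * w :=
    fun w => by rw [Module.algebraMap_end_apply, Algebra.smul_def]
  simp only [Function.Bijective, Function.Injective, Function.Surjective, this]
  refine ⟨fun _ _ h => hu.mul_left_cancel h, fun w => ?_⟩
  obtain ⟨v, hv⟩ := hu.exists_right_inv
  exact ⟨v * w, by rw [← mul_assoc, hv, one_mul]⟩

open Classical in
/-- The map `M[1/a] → T` extending `ν : M → T` when `a` is a unit in `T` (and zero otherwise). -/
noncomputable def locEval (a : R) (ν : M →ₗ[R] T) : Loc a M →ₗ[R] T :=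
  if h : IsUnit (algebraMap R T a) then
    LocalizedModule.lift (Submonoid.powers a) ν (isUnit_end_of_mem_powers h)
  else 0

variable {a b : R} {ν : M →ₗ[R] T}

theorem locEval_mkLinearMap (ha : IsUnit (algebraMap R T a)) (m : M) :
    locEval a ν (LocalizedModule.mkLinearMap (Submonoid.powers a) M m) = ν m := by
  rw [locEval, dif_pos ha]
  exact LinearMap.congr_fun (LocalizedModule.lift_comp (Submonoid.powers a) ν
    (isUnit_end_of_mem_powers ha)) m

theorem smul_mk_eq (m : M) (s : Submonoid.powers a) :
    (s : R) • (LocalizedModule.mk m s : Loc a M) =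
      LocalizedModule.mkLinearMap (Submonoid.powers a) M m := by
  rw [LocalizedModule.mkLinearMap_apply, LocalizedModule.smul'_mk]
  exact LocalizedModule.mk_cancel s m

theorem smul_locEval_mk (ha : IsUnit (algebraMap R T a)) (m : M) (s : Submonoid.powers a) :
    (s : R) • locEval a ν (LocalizedModule.mk m s) = ν m := by
  rw [← map_smul, smul_mk_eq, locEval_mkLinearMap ha]

theorem smul_cancel_of_isUnit {r : R} (hr : IsUnit (algebraMap R T r)) {v w : T}
    (h : r • v = r • w) : v = w := by
  rw [Algebra.smul_def, Algebra.smul_def] at h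
  exact hr.mul_left_cancel h

theorem isUnit_of_mem_powers (ha : IsUnit (algebraMap R T a)) (s : Submonoid.powers a) :
    IsUnit (algebraMap R T (s : R)) := by
  obtain ⟨s, n, rfl⟩ := s
  rw [map_pow]; exact ha.pow n

theorem locEval_locRes (h : a ∣ b) (hb : IsUnit (algebraMap R T b)) (z : Loc a M) :
    locEval b ν (locRes h M z) = locEval a ν z := by
  have ha : IsUnit (algebraMap R T a) := isUnit_of_dvd_unit (map_dvd _ h) hb
  induction z using LocalizedModule.induction_on with
  | _ m s =>
    refine smul_cancel_of_isUnit (isUnit_of_mem_powers ha s) ?_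
    rw [smul_locEval_mk ha, ← map_smul, ← map_smul, smul_mk_eq, locRes_mk, locEval_mkLinearMap hb]

theorem locEval_locMap {N : Type*} [AddCommGroup N] [Module R N] {ν' : N →ₗ[R] T} {f : M →ₗ[R] N}
    (hf : ∀ m, ν' (f m) = ν m) (ha : IsUnit (algebraMap R T a)) (z : Loc a M) :
    locEval a ν' (locMap a f z) = locEval a ν z := by
  induction z using LocalizedModule.induction_on with
  | _ m s =>
    refine smul_cancel_of_isUnit (isUnit_of_mem_powers ha s) ?_
    rw [smul_locEval_mk ha, ← map_smul, ← map_smul, smul_mk_eq, locMap,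
      IsLocalizedModule.map_apply, locEval_mkLinearMap ha, hf]

theorem locEval_injective (hν : Function.Injective ν) (ha : IsUnit (algebraMap R T a)) :
    Function.Injective (locEval a ν) := by
  rw [injective_iff_map_eq_zero]
  intro z hz
  induction z using LocalizedModule.induction_on with
  | _ m s =>
    have h1 := smul_locEval_mk (ν := ν) ha m s
    rw [hz, smul_zero] at h1
    rw [(injective_iff_map_eq_zero ν).1 hν m h1.symm, LocalizedModule.zero_mk]

theorem exists_pow_smul_locEval_mem (ha : IsUnit (algebraMap R T a)) (z : Loc a M) :
    ∃ N : ℕ, a ^ N • locEval a ν z ∈ LinearMap.range ν := by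
  induction z using LocalizedModule.induction_on with
  | _ m s =>
    obtain ⟨N, hN⟩ := s.2
    exact ⟨N, m, by rw [← smul_locEval_mk (ν := ν) ha m s, ← hN]⟩

theorem exists_locEval_eq (ha : IsUnit (algebraMap R T a)) {w : T} {N : ℕ}
    (hw : a ^ N • w ∈ LinearMap.range ν) : ∃ z : Loc a M, locEval a ν z = w := by
  obtain ⟨m, hm⟩ := hw
  refine ⟨LocalizedModule.mk m ⟨a ^ N, N, rfl⟩, ?_⟩
  refine smul_cancel_of_isUnit (isUnit_of_mem_powers ha ⟨a ^ N, N, rfl⟩) ?_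
  rw [smul_locEval_mk ha, hm]

/-- A supporting family may contain zeros, which are not units in T. The Čech terms involving them
vanish, so only the nonzero members matter. -/
theorem subsingleton_loc_of_eq_zero (ha : a = 0) : Subsingleton (Loc a M) := by
  subst ha
  refine subsingleton_of_forall_eq 0 fun z => ?_
  induction z using LocalizedModule.induction_on with
  | _ m s =>
    rw [← LocalizedModule.zero_mk s, LocalizedModule.mk_eq]
    exact ⟨⟨0, 1, by simp⟩, by simp [Submonoid.smul_def]⟩

theorem locEval_mem_of_mem_locDegree {K : Type v} [Field K] [Algebra K R] {𝒜 : ℕ → Submodule K R}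
    {σ : Type*} [SetLike σ T] [AddSubgroupClass σ T] {𝒯 : ℚ → σ} [GradedRing 𝒯]
    (hmap : ∀ i, ∀ r ∈ 𝒜 i, algebraMap R T r ∈ 𝒯 (i : ℚ)) (ha : IsUnit (algebraMap R T a)) {m : ℤ}
    {z : Loc a R} (hz : z ∈ locDegree 𝒜 a m) :
    locEval a (Algebra.linearMap R T) z ∈ 𝒯 (m : ℚ) := by
  induction hz using AddSubgroup.closure_induction with
  | mem z hz =>
    obtain ⟨i, j, r, s, hr, hs, hm, rfl⟩ := hz
    refine mem_of_mul_mem (isUnit_of_mem_powers ha s) (hmap j _ hs) ?_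
    rw [← Algebra.smul_def, smul_locEval_mk ha]
    have : (j : ℚ) + m = i := by rw [← hm]; push_cast; ring
    rw [this]
    exact hmap i r hr
  | zero => rw [map_zero]; exact zero_mem _
  | add a b _ _ ha hb => rw [map_add]; exact add_mem ha hb
  | neg a _ ha => rw [map_neg]; exact neg_mem ha

end LocEval

/-! ### Increasing sequences as finite subsets. -/

variable {ι : Type*} [LinearOrder ι] {n : ℕ} (ε : Fin n ↪o ι)

/-- The subset of `ι` given by an increasing sequence. -/
def seqSet {k : ℕ} (σ : Fin k ↪o Fin n) : Finset ι :=
  Finset.univ.map (σ.trans ε).toEmbedding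

theorem card_seqSet {k : ℕ} (σ : Fin k ↪o Fin n) : (seqSet ε σ).card = k := by
  simp [seqSet]

theorem seqSet_injective {k : ℕ} : Function.Injective (seqSet ε : (Fin k ↪o Fin n) → Finset ι) := by
  intro σ τ h
  have h1 := Finset.orderEmbOfFin_unique' (card_seqSet ε σ) (f := σ.trans ε)
    (fun j => by simp [seqSet])
  have h2 := Finset.orderEmbOfFin_unique' (card_seqSet ε σ) (f := τ.trans ε)
    (fun j => by rw [h]; simp [seqSet])
  have h3 := h1.trans h2.symm
  ext j
  have := DFunLike.congr_fun h3 j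
  simp only [RelEmbedding.coe_trans, Function.comp_apply, EmbeddingLike.apply_eq_iff_eq] at this
  rw [this]

theorem seqSet_face {k : ℕ} (σ : Fin (k + 1) ↪o Fin n) (j : Fin (k + 1)) :
    seqSet ε (face σ j) = (seqSet ε σ).erase (ε (σ j)) := by
  ext i
  simp only [seqSet, face, Finset.mem_map, Finset.mem_univ, true_and, Finset.mem_erase]
  constructor
  · rintro ⟨l, rfl⟩
    exact ⟨fun h => Fin.succAbove_ne j l (σ.injective (ε.injective h)), j.succAbove l, rfl⟩
  · rintro ⟨h, l, rfl⟩
    obtain ⟨l', hl'⟩ := Fin.exists_succAbove_eq (x := l) (y := j) (by rintro rfl; exact h rfl)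
    exact ⟨l', congrArg (fun l => ε (σ l)) hl'⟩

/-- Exactly j members of the sequence precede its j-th entry, so the signs agree with those of
`diff`. -/
theorem faceSign_seqSet {k : ℕ} (σ : Fin k ↪o Fin n) (j : Fin k) :
    faceSign (seqSet ε σ) (ε (σ j)) = (-1) ^ (j : ℕ) := by
  have : (seqSet ε σ).filter (· < ε (σ j)) =
      (Finset.univ.filter (· < j)).map (σ.trans ε).toEmbedding := by
    rw [seqSet, Finset.filter_map]
    congr 1
    ext l
    simp only [Finset.mem_filter, Finset.mem_univ, true_and]
    exact ε.lt_iff_lt.trans σ.lt_iff_lt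
  rw [faceSign, this, Finset.card_map]
  congr 1
  rw [Finset.filter_gt_eq_Iio, Fin.card_Iio]

theorem exists_seqSet_eq {U : Finset (Fin n)} {s : Finset ι} (hs : s ⊆ U.map ε.toEmbedding) :
    ∃ (σ : Fin s.card ↪o Fin n), seqSet ε σ = s ∧ ∀ j, σ j ∈ U := by
  obtain ⟨u, hu, rfl⟩ := Finset.subset_map_iff.1 hs
  rw [Finset.card_map]
  refine ⟨u.orderEmbOfFin rfl, ?_, fun j => hu (Finset.orderEmbOfFin_mem u rfl j)⟩
  ext i
  simp only [seqSet, Finset.mem_map, Finset.mem_univ, true_and]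
  constructor
  · rintro ⟨j, rfl⟩
    exact ⟨_, Finset.orderEmbOfFin_mem u rfl j, rfl⟩
  · rintro ⟨a, ha, rfl⟩
    have : a ∈ Set.range (u.orderEmbOfFin rfl) := by rw [Finset.range_orderEmbOfFin]; exact ha
    obtain ⟨j, rfl⟩ := this
    exact ⟨j, rfl⟩

variable {x : Fin n → R} {z : ι → R}

theorem prodAt_eq_prod_seqSet (hz : ∀ i, z (ε i) = x i) {k : ℕ} (σ : Fin k ↪o Fin n) :
    prodAt x σ = ∏ i ∈ seqSet ε σ, z i := by
  rw [seqSet, Finset.prod_map, prodAt]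
  exact Finset.prod_congr rfl fun j _ => (hz _).symm

variable {M : Type w'} [AddCommGroup M] [Module R M]

open Classical in
/-- The function on finite subsets given by a Čech cochain. -/
noncomputable def cochainFun (ν : M →ₗ[R] T) {k : ℕ} (c : Cochain x M k) (s : Finset ι) : T :=
  if h : ∃ σ : Fin k ↪o Fin n, seqSet ε σ = s then locEval (prodAt x h.choose) ν (c h.choose) else 0

variable {ν : M →ₗ[R] T} {k : ℕ}

theorem cochainFun_seqSet (c : Cochain x M k) (σ : Fin k ↪o Fin n) :
    cochainFun ε ν c (seqSet ε σ) = locEval (prodAt x σ) ν (c σ) := by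
  have h : ∃ τ : Fin k ↪o Fin n, seqSet ε τ = seqSet ε σ := ⟨σ, rfl⟩
  rw [cochainFun, dif_pos h]
  have := seqSet_injective ε h.choose_spec
  rw [this]

theorem cochainFun_of_card_ne (c : Cochain x M k) {s : Finset ι} (hs : s.card ≠ k) :
    cochainFun ε ν c s = 0 := by
  rw [cochainFun, dif_neg]
  rintro ⟨σ, rfl⟩
  exact hs (card_seqSet ε σ)

theorem codiff_cochainFun_seqSet (c : Cochain x M k) (σ : Fin (k + 1) ↪o Fin n)
    (hu : IsUnit (algebraMap R T (prodAt x σ))) :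
    codiff (cochainFun ε ν c) (seqSet ε σ) = locEval (prodAt x σ) ν (diff x M k c σ) := by
  have h1 : codiff (cochainFun ε ν c) (seqSet ε σ) = ∑ j : Fin (k + 1),
      faceSign (seqSet ε σ) (ε (σ j)) • cochainFun ε ν c ((seqSet ε σ).erase (ε (σ j))) := by
    rw [codiff]
    conv_lhs => rw [show (seqSet ε σ) = Finset.univ.map (σ.trans ε).toEmbedding from rfl]
    rw [Finset.sum_map]
    rfl
  rw [h1, diff, LinearMap.pi_apply, LinearMap.sum_apply, map_sum]
  refine Finset.sum_congr rfl fun j _ => ?_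
  rw [faceSign_seqSet, ← seqSet_face, cochainFun_seqSet, LinearMap.smul_apply,
    LinearMap.comp_apply, LinearMap.proj_apply, map_smul, locEval_locRes _ hu]
  rcases Nat.even_or_odd (j : ℕ) with h | h
  · rw [h.neg_one_pow, h.neg_one_pow, one_smul, one_smul]
  · rw [h.neg_one_pow, h.neg_one_pow, neg_smul, neg_smul, one_smul, one_smul]

theorem codiff_cochainFun_eq_zero {U : Finset (Fin n)}
    (hu : ∀ i ∈ U, IsUnit (algebraMap R T (x i))) {c : Cochain x M k} (hc : c ∈ cocycles x M k)
    {s : Finset ι} (hs : s ⊆ U.map ε.toEmbedding) : codiff (cochainFun ε ν c) s = 0 := by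
  by_cases hcard : s.card = k + 1
  · obtain ⟨σ, hσ, hσU⟩ := exists_seqSet_eq ε hs
    revert σ
    rw [hcard]
    rintro σ rfl hσU
    rw [codiff_cochainFun_seqSet]
    · rw [LinearMap.mem_ker.1 hc]; simp
    · rw [prodAt, map_prod]
      exact IsUnit.prod_univ_iff.2 fun j => hu _ (hσU j)
  · refine Finset.sum_eq_zero fun i hi => ?_
    rw [cochainFun_of_card_ne, smul_zero]
    rw [Finset.card_erase_of_mem hi]
    have := Finset.card_pos.2 ⟨i, hi⟩
    omega

theorem cochainFun_mem_locIn (hz : ∀ i, z (ε i) = x i) {U : Finset (Fin n)}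
    (hu : ∀ i ∈ U, IsUnit (algebraMap R T (x i))) (c : Cochain x M k)
    {s : Finset ι} (hs : s ⊆ U.map ε.toEmbedding) :
    cochainFun ε ν c s ∈ locIn (LinearMap.range ν) z s := by
  by_cases hcard : s.card = k
  · obtain ⟨σ, hσ, hσU⟩ := exists_seqSet_eq ε hs
    revert σ
    rw [hcard]
    rintro σ rfl hσU
    rw [cochainFun_seqSet, mem_locIn, ← prodAt_eq_prod_seqSet ε hz]
    refine exists_pow_smul_locEval_mem ?_ _
    rw [prodAt, map_prod]
    exact IsUnit.prod_univ_iff.2 fun j => hu _ (hσU j)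
  · rw [cochainFun_of_card_ne ε c hcard]
    exact zero_mem _

/-- The values of b lift to the localized modules. Equality of the differential with c is checked in
T by injectivity of `locEval` where all entries lie in U, and is vacuous elsewhere because an entry
is 0. -/
theorem mem_coboundaries_of_codiff_eq (hz : ∀ i, z (ε i) = x i) (hν : Function.Injective ν)
    {U : Finset (Fin n)} (hu : ∀ i ∈ U, IsUnit (algebraMap R T (x i))) (hU : ∀ i ∉ U, x i = 0)
    {c : Cochain x M (k + 1)} {b : Finset ι → T}
    (hb : ∀ s ⊆ U.map ε.toEmbedding, b s ∈ locIn (LinearMap.range ν) z s)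
    (hbc : ∀ s ⊆ U.map ε.toEmbedding, codiff b s = cochainFun ε ν c s) :
    c ∈ coboundaries x M (k + 1) := by
  classical
  have hsub : ∀ {l : ℕ} (σ : Fin l ↪o Fin n),
      seqSet ε σ ⊆ U.map ε.toEmbedding ↔ ∀ j, σ j ∈ U := by
    intro l σ
    constructor
    · intro h j
      have : ε (σ j) ∈ seqSet ε σ := Finset.mem_map.2 ⟨j, Finset.mem_univ j, rfl⟩
      obtain ⟨i, hi, hij⟩ := Finset.mem_map.1 (h this)
      rwa [← ε.injective hij]
    · intro h i hi
      obtain ⟨j, _, rfl⟩ := Finset.mem_map.1 hi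
      exact Finset.mem_map.2 ⟨σ j, h j, rfl⟩
  have hunit : ∀ {l : ℕ} (σ : Fin l ↪o Fin n), seqSet ε σ ⊆ U.map ε.toEmbedding →
      IsUnit (algebraMap R T (prodAt x σ)) := by
    intro l σ h
    rw [prodAt, map_prod]
    exact IsUnit.prod_univ_iff.2 fun j => hu _ ((hsub σ).1 h j)
  have hex : ∀ τ : Fin k ↪o Fin n, ∃ y : Loc (prodAt x τ) M,
      seqSet ε τ ⊆ U.map ε.toEmbedding → locEval (prodAt x τ) ν y = b (seqSet ε τ) := by
    intro τ
    by_cases h : seqSet ε τ ⊆ U.map ε.toEmbedding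
    · obtain ⟨N, hN⟩ := hb _ h
      rw [← prodAt_eq_prod_seqSet ε hz] at hN
      obtain ⟨y, hy⟩ := exists_locEval_eq (hunit τ h) hN
      exact ⟨y, fun _ => hy⟩
    · exact ⟨0, fun h' => absurd h' h⟩
  choose y hy using hex
  refine ⟨y, ?_⟩
  ext σ
  by_cases h : seqSet ε σ ⊆ U.map ε.toEmbedding
  · apply locEval_injective hν (hunit σ h)
    rw [← codiff_cochainFun_seqSet ε y σ (hunit σ h), ← cochainFun_seqSet ε c σ, ← hbc _ h]
    refine Finset.sum_congr rfl fun i hi => ?_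
    obtain ⟨j, _, rfl⟩ := Finset.mem_map.1 hi
    congr 1
    change cochainFun ε ν y ((seqSet ε σ).erase (ε (σ j))) = b ((seqSet ε σ).erase (ε (σ j)))
    have hsub' : seqSet ε (face σ j) ⊆ U.map ε.toEmbedding := by
      rw [seqSet_face]; exact (Finset.erase_subset _ _).trans h
    rw [← seqSet_face, cochainFun_seqSet, hy _ hsub']
  · rw [hsub] at h
    push Not at h
    obtain ⟨j, hj⟩ := h
    have := subsingleton_loc_of_eq_zero (M := M)
      (show prodAt x σ = 0 from Finset.prod_eq_zero (Finset.mem_univ j) (hU _ hj))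
    exact Subsingleton.elim _ _

end Translation

end GradedLC

namespace GradedLC

/-! ### Killing local cohomology in nonnegative degrees -/

section Killing

/-- Put the i-th summand, with its face sign, on the face opposite i. The signs square to 1 on the
full set, and on smaller sets both sides vanish by cardinality. -/
theorem exists_codiff_of_mem_faceSum {R : Type u} {T : Type w} [CommRing R] [CommRing T]
    [Algebra R T] {ι : Type*} [LinearOrder ι] {d : ℕ} (ε : Fin d ↪o ι) {t : Fin d → R} {z : ι → R}
    (hz : ∀ i, z (ε i) = t i) {M : Submodule R T} {c : Finset ι → T}
    (hcard : ∀ s, s.card ≠ d → c s = 0)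
    (hc : c (Finset.univ.map ε.toEmbedding) ∈ faceSum M t) :
    ∃ b : Finset ι → T, (∀ s ⊆ Finset.univ.map ε.toEmbedding, b s ∈ locIn M z s) ∧
      ∀ s ⊆ Finset.univ.map ε.toEmbedding, codiff b s = c s := by
  classical
  obtain ⟨β, hβ, hsum⟩ := mem_faceSum.1 hc
  set U := Finset.univ.map ε.toEmbedding with hU
  have hεU : ∀ i, ε i ∈ U := fun i => Finset.mem_map.2 ⟨i, Finset.mem_univ i, rfl⟩
  have hUcard : U.card = d := by simp [hU]
  refine ⟨fun s => ∑ i, if s = U.erase (ε i) then faceSign U (ε i) • β i else 0, ?_, ?_⟩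
  · intro s _
    refine Submodule.sum_mem _ fun i _ => ?_
    by_cases h : s = U.erase (ε i)
    · rw [if_pos h, h]
      apply zsmul_mem_locIn
      obtain ⟨N, hN⟩ := hβ i
      refine ⟨N, ?_⟩
      have : ∏ j ∈ U.erase (ε i), z j = ∏ j ∈ Finset.univ.erase i, t j := by
        have h1 : U.erase (ε i) = (Finset.univ.erase i).map ε.toEmbedding := by
          rw [Finset.map_erase]; rfl
        rw [h1, Finset.prod_map]
        exact Finset.prod_congr rfl fun j _ => hz j
      rwa [this]
    · rw [if_neg h]; exact zero_mem _
  · intro s hs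
    by_cases h : s = U
    · subst h
      rw [codiff, ← hsum, hU, Finset.sum_map]
      refine Finset.sum_congr rfl fun i _ => ?_
      change faceSign U (ε i) • ∑ j, (if U.erase (ε i) = U.erase (ε j) then
        faceSign U (ε j) • β j else 0) = β i
      rw [Finset.sum_eq_single i, if_pos rfl, smul_smul, faceSign_mul_self, one_smul]
      · intro j _ hj
        rw [if_neg]
        intro h
        have h1 : ε i ∈ U.erase (ε j) :=
          Finset.mem_erase.2 ⟨fun h => hj (ε.injective h).symm, hεU i⟩
        rw [← h] at h1
        exact Finset.notMem_erase _ _ h1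
      · exact fun h => absurd (Finset.mem_univ i) h
    · have hlt : s.card < d := by
        rw [← hUcard]; exact Finset.card_lt_card (hs.ssubset_of_ne h)
      rw [hcard s hlt.ne]
      refine Finset.sum_eq_zero fun k hk => ?_
      beta_reduce
      rw [Finset.sum_eq_zero, smul_zero]
      intro i _
      rw [if_neg]
      intro h1
      have h2 := congrArg Finset.card h1
      rw [Finset.card_erase_of_mem hk, Finset.card_erase_of_mem (hεU i), hUcard] at h2
      have := Finset.card_pos.2 ⟨k, hk⟩
      omega

variable {K : Type v} {R : Type u} {T : Type w} [Field K] [CommRing R] [Algebra K R]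
  [CommRing T] [Algebra R T] {σ : Type*} [SetLike σ T] [AddSubgroupClass σ T]
  {𝒯 : ℚ → σ} [GradedRing 𝒯] {𝒜 : ℕ → Submodule K R} [GradedAlgebra 𝒜]

/-- If `S` kills the nonnegative part of the top local cohomology computed with the parameters
`t`, then it does so for the Čech complex of every family supporting the irrelevant ideal. -/
theorem cochainMap_mem_coboundaries
    (hmap : ∀ i, ∀ r ∈ 𝒜 i, algebraMap R T r ∈ 𝒯 (i : ℚ))
    (hunit : ∀ i, ∀ r ∈ 𝒜 i, r ≠ 0 → IsUnit (algebraMap R T r))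
    {d : ℕ} (hd : 0 < d) {t : Fin d → R} {δ : Fin d → ℕ}
    (ht : ∀ i, 0 < δ i ∧ t i ∈ 𝒜 (δ i) ∧ t i ≠ 0)
    (hrad : (HomogeneousIdeal.irrelevant 𝒜).toIdeal ≤ (Ideal.span (Set.range t)).radical)
    {S : Subalgebra R T}
    (hS : ∀ m : ℚ, 0 ≤ m → ∀ α ∈ 𝒯 m,
      α ∈ locIn (Subalgebra.toSubmodule (⊥ : Subalgebra R T)) t Finset.univ →
      α ∈ faceSum (Subalgebra.toSubmodule S) t)
    {n : ℕ} {x : Fin n → R} (hx : Supports 𝒜 x) {m : ℕ} {c : Cochain x R d}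
    (hc : c ∈ cocycles x R d) (hcdeg : ∀ τ, c τ ∈ locDegree 𝒜 (prodAt x τ) m) :
    cochainMap x (Algebra.linearMap R S) d c ∈ coboundaries x S d := by
  classical
  let z : Fin (n + d) → R := Fin.append x t
  let εx : Fin n ↪o Fin (n + d) := Fin.castAddOrderEmb d
  let εt : Fin d ↪o Fin (n + d) := Fin.natAddOrderEmb n
  have hzx : ∀ i, z (εx i) = x i := fun i => Fin.append_left x t i
  have hzt : ∀ i, z (εt i) = t i := fun i => Fin.append_right x t i
  -- Only the nonzero members of x become units in T; discarding the zeros does not change the ideal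
  -- they generate.
  let V : Finset (Fin n) := Finset.univ.filter fun i => x i ≠ 0
  have hVunit : ∀ i ∈ V, IsUnit (algebraMap R T (x i)) := by
    intro i hi
    obtain ⟨j, hj⟩ := hx.1 i
    exact hunit j _ hj (Finset.mem_filter.1 hi).2
  have hV0 : ∀ i ∉ V, x i = 0 := fun i hi => by
    by_contra h
    exact hi (Finset.mem_filter.2 ⟨Finset.mem_univ i, h⟩)
  set U := V.map εx.toEmbedding with hU
  set W := Finset.univ.map εt.toEmbedding with hW
  have hUunit : ∀ j ∈ U, IsUnit (algebraMap R T (z j)) := by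
    intro j hj
    obtain ⟨i, hi, rfl⟩ := Finset.mem_map.1 hj
    exact (hzx i).symm ▸ hVunit i hi
  have hWunit : ∀ j ∈ W, IsUnit (algebraMap R T (z j)) := by
    intro j hj
    obtain ⟨i, _, rfl⟩ := Finset.mem_map.1 hj
    exact (hzt i).symm ▸ hunit _ _ (ht i).2.1 (ht i).2.2
  have hUrad : (HomogeneousIdeal.irrelevant 𝒜).toIdeal = (Ideal.span (z '' U)).radical := by
    rw [← hx.2]
    congr 1
    refine le_antisymm (Ideal.span_le.2 ?_) (Ideal.span_mono ?_)
    · rintro _ ⟨i, rfl⟩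
      by_cases h : i ∈ V
      · exact Ideal.subset_span ⟨εx i, Finset.mem_map.2 ⟨i, h, rfl⟩, hzx i⟩
      · rw [hV0 i h]; exact zero_mem _
    · rintro _ ⟨j, hj, rfl⟩
      obtain ⟨i, _, rfl⟩ := Finset.mem_map.1 hj
      exact ⟨i, (hzx i).symm⟩
  have hWrad : (HomogeneousIdeal.irrelevant 𝒜).toIdeal ≤ (Ideal.span (z '' W)).radical := by
    refine hrad.trans (Ideal.radical_mono (Ideal.span_mono ?_))
    rintro _ ⟨i, rfl⟩
    exact ⟨εt i, Finset.mem_map.2 ⟨i, Finset.mem_univ i, rfl⟩, hzt i⟩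
  have hWU : ∀ j ∈ W, z j ∈ (Ideal.span (z '' U)).radical := by
    intro j hj
    obtain ⟨i, _, rfl⟩ := Finset.mem_map.1 hj
    rw [← hUrad]
    exact (hzt i).symm ▸ HomogeneousIdeal.mem_irrelevant_of_mem 𝒜 (ht i).1 (ht i).2.1
  have hUW : ∀ j ∈ U, z j ∈ (Ideal.span (z '' W)).radical := by
    intro j hj
    refine hWrad ?_
    rw [hUrad]
    exact Ideal.le_radical (Ideal.subset_span ⟨j, hj, rfl⟩)
  have hzdeg : ∀ j ∈ W ∪ U, ∃ q : ℚ, algebraMap R T (z j) ∈ 𝒯 q := by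
    intro j hj
    rcases Finset.mem_union.1 hj with hj | hj
    · obtain ⟨i, _, rfl⟩ := Finset.mem_map.1 hj
      exact ⟨δ i, (hzt i).symm ▸ hmap _ _ (ht i).2.1⟩
    · obtain ⟨i, _, rfl⟩ := Finset.mem_map.1 hj
      obtain ⟨l, hl⟩ := hx.1 i
      exact ⟨l, (hzx i).symm ▸ hmap _ _ hl⟩
  choose! δz hδz using hzdeg
  set ν := Algebra.linearMap R T with hν
  have hrange : LinearMap.range ν = Subalgebra.toSubmodule (⊥ : Subalgebra R T) := by
    ext w
    rw [LinearMap.mem_range, Subalgebra.mem_toSubmodule, Algebra.mem_bot]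
    rfl
  set M := Subalgebra.toSubmodule (⊥ : Subalgebra R T) with hMdef
  have hM : ∀ v ∈ M, ∀ q, (DirectSum.decompose 𝒯 v q : T) ∈ M := decompose_mem_bot hmap
  have hc₀deg : ∀ s ⊆ U, cochainFun εx ν c s ∈ 𝒯 (m : ℚ) := by
    intro s hs
    by_cases hcard : s.card = d
    · obtain ⟨τ, hτ, hτV⟩ := exists_seqSet_eq εx hs
      revert τ
      rw [hcard]
      rintro τ rfl hτV
      rw [cochainFun_seqSet]
      have := locEval_mem_of_mem_locDegree hmap (by
        rw [prodAt, map_prod]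
        exact IsUnit.prod_univ_iff.2 fun j => hVunit _ (hτV j)) (hcdeg τ)
      exact_mod_cast this
    · rw [cochainFun_of_card_ne εx c hcard]; exact zero_mem _
  obtain ⟨c₁, hc₁mem, hc₁coc, hc₁U⟩ := exists_cocycle_union (M := M) hWunit hWU
    (fun s hs => hrange ▸ cochainFun_mem_locIn εx hzx hVunit c hs)
    (fun s hs => codiff_cochainFun_eq_zero εx (ν := ν) hVunit hc hs)
  -- The extension c₁ is controlled neither in degree nor in cardinality. Its degree m part on
  -- d-element sets is still a cocycle and still extends c, which is homogeneous of degree m.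
  let c₂ : Finset (Fin (n + d)) → T := fun s =>
    if s.card = d then (DirectSum.decompose 𝒯 (c₁ s) (m : ℚ) : T) else 0
  have hc₂card : ∀ s, s.card ≠ d → c₂ s = 0 := fun s hs => if_neg hs
  have hc₂mem : ∀ s ⊆ W ∪ U, c₂ s ∈ locIn M z s := by
    intro s hs
    by_cases hcard : s.card = d
    · simp only [c₂, if_pos hcard]
      exact decompose_mem_locIn hM (fun i hi => hδz i (hs hi)) (hc₁mem s hs) _
    · rw [hc₂card s hcard]; exact zero_mem _
  have hc₂coc : ∀ s ⊆ W ∪ U, codiff c₂ s = 0 := by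
    intro s hs
    by_cases hcard : s.card = d + 1
    · let π : T →+ T := (AddSubgroupClass.subtype (𝒯 (m : ℚ)) : 𝒯 (m : ℚ) →+ T).comp
        ((DFinsupp.evalAddMonoidHom (m : ℚ)).comp
          (DirectSum.decomposeAddEquiv 𝒯).toAddMonoidHom)
      have h1 : codiff c₂ s = codiff (fun s => π (c₁ s)) s := by
        refine Finset.sum_congr rfl fun i hi => ?_
        congr 1
        exact if_pos (by rw [Finset.card_erase_of_mem hi, hcard, Nat.add_sub_cancel])
      rw [h1, codiff_map, hc₁coc s hs, map_zero]
    · refine Finset.sum_eq_zero fun i hi => ?_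
      rw [hc₂card, smul_zero]
      rw [Finset.card_erase_of_mem hi]
      have := Finset.card_pos.2 ⟨i, hi⟩
      omega
  have hc₂U : ∀ s ⊆ U, c₂ s = cochainFun εx ν c s := by
    intro s hs
    by_cases hcard : s.card = d
    · simp only [c₂, if_pos hcard]
      rw [hc₁U s hs, DirectSum.decompose_of_mem_same 𝒯 (hc₀deg s hs)]
    · rw [hc₂card s hcard, cochainFun_of_card_ne εx c hcard]
  have hWcard : W.card = d := by simp [hW]
  have hface : c₂ W ∈ faceSum (Subalgebra.toSubmodule S) t := by
    refine hS m (by positivity) _ ?_ ?_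
    · simp only [c₂, if_pos hWcard]
      exact SetLike.coe_mem _
    · obtain ⟨N, hN⟩ := hc₂mem W Finset.subset_union_left
      refine ⟨N, ?_⟩
      have : ∏ j ∈ W, z j = ∏ j, t j := by
        rw [hW, Finset.prod_map]
        exact Finset.prod_congr rfl fun j _ => hzt j
      rwa [this] at hN
  -- The roles are exchanged: the value on W, which is a top class for t, is split into faces over
  -- S, and the resulting primitive extends to the vertices of x. Its restriction to U is the one
  -- sought.
  obtain ⟨b, hb, hbc⟩ := exists_codiff_eq_union (M := Subalgebra.toSubmodule S) (U := W) (W := U)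
    hUunit hUW (c := c₂)
    (fun s hs => locIn_mono (Subalgebra.toSubmodule.monotone bot_le) s
      (hc₂mem s (Finset.union_comm U W ▸ hs)))
    (fun s hs => hc₂coc s (Finset.union_comm U W ▸ hs))
    (exists_codiff_of_mem_faceSum εt hzt hc₂card hface)
  obtain ⟨k, rfl⟩ : ∃ k, d = k + 1 := ⟨d - 1, by omega⟩
  have hSrange : LinearMap.range S.val.toLinearMap = Subalgebra.toSubmodule S := by
    ext w
    simp
  refine mem_coboundaries_of_codiff_eq εx (ν := S.val.toLinearMap) hzx Subtype.val_injective hVunit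
    hV0 (b := b) (fun s hs => hSrange ▸ hb s (hs.trans Finset.subset_union_left)) ?_
  intro s hs
  rw [hbc s (hs.trans Finset.subset_union_left), hc₂U s hs]
  by_cases hcard : s.card = k + 1
  · obtain ⟨τ, hτ, hτV⟩ := exists_seqSet_eq εx hs
    revert τ
    rw [hcard]
    rintro τ rfl hτV
    rw [cochainFun_seqSet, cochainFun_seqSet]
    refine (locEval_locMap (fun r => rfl) ?_ _).symm
    rw [prodAt, map_prod]
    exact IsUnit.prod_univ_iff.2 fun j => hVunit _ (hτV j)
  · rw [cochainFun_of_card_ne εx _ hcard, cochainFun_of_card_ne εx _ hcard]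

end Killing

/-! ### From cocycles to cohomology classes. -/

section LocalCohomology

variable {K : Type v} {R : Type u} [Field K] [CommRing R] [Algebra K R] {𝒜 : ℕ → Submodule K R}
  {n : ℕ} {x : Fin n → R}

theorem localCohMap_mk_eq_zero {M : Type w} {N : Type w'} [AddCommGroup M] [Module R M]
    [AddCommGroup N] [Module R N] (f : M →ₗ[R] N) {k : ℕ} {c : cocycles x M k}
    (hc : cochainMap x f k c ∈ coboundaries x N k) :
    localCohMap x f k (((coboundaries x M k).submoduleOf (cocycles x M k)).mkQ c) = 0 := by
  exact (Submodule.Quotient.mk_eq_zero _).2 hc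

theorem localCohMap_eq_zero_of_mem_localCohNonneg {N : Type w'} [AddCommGroup N] [Module R N]
    (f : R →ₗ[R] N) {k : ℕ}
    (h : ∀ (m : ℕ) (c : Cochain x R k), c ∈ cocycles x R k →
      (∀ τ, c τ ∈ locDegree 𝒜 (prodAt x τ) m) → cochainMap x f k c ∈ coboundaries x N k) :
    ∀ η ∈ localCohNonneg 𝒜 x k, localCohMap x f k η = 0 := by
  intro η hη
  have hle : localCohNonneg 𝒜 x k ≤ LinearMap.ker (localCohMap x f k) := by
    refine Submodule.span_le.2 ?_
    intro ξ hξ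
    obtain ⟨m, hm⟩ := Set.mem_iUnion.1 hξ
    obtain ⟨c, hc, rfl⟩ := hm
    exact localCohMap_mk_eq_zero f (h m c c.2 fun τ => hc τ (Set.mem_univ τ))
  exact hle hη

theorem cochainMap_comp {M : Type*} {N : Type*} {P : Type*} [AddCommGroup M] [Module R M]
    [AddCommGroup N] [Module R N] [AddCommGroup P] [Module R P] (f : M →ₗ[R] N) (g : N →ₗ[R] P)
    {k : ℕ} (c : Cochain x M k) :
    cochainMap x (g ∘ₗ f) k c = cochainMap x g k (cochainMap x f k c) := by
  ext τ
  exact LinearMap.congr_fun (IsLocalizedModule.map_comp' (Submonoid.powers (prodAt x τ))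
    (LocalizedModule.mkLinearMap _ M) (LocalizedModule.mkLinearMap _ N)
    (LocalizedModule.mkLinearMap _ P) f g) (c τ)

end LocalCohomology

end GradedLC

/-! ### Assembly: S kills the nonnegative part, and R^{+GR} receives a map from S. -/

theorem proposition5p4 {K : Type v} {R : Type u} [Field K] [CommRing R] [IsDomain R]
    [Algebra K R] [Algebra.FiniteType K R]
    (p : ℕ) [Fact p.Prime] [CharP K p]
    (𝒜 : ℕ → Submodule K R) [GradedAlgebra 𝒜] (h0 : 𝒜 0 = 1)
    (d : ℕ) (hd : ringKrullDim R = d) (hpos : 0 < d) :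
    (∀ (n : ℕ) (x : Fin n → R), GradedLC.Supports 𝒜 x →
      ∀ η ∈ GradedLC.localCohNonneg 𝒜 x d,
        GradedLC.localCohMap x (Algebra.linearMap R (GradedLC.PlusGR 𝒜)) d η = 0) ∧
    ∃ (S : Type u) (_ : CommRing S) (_ : IsDomain S) (_ : Algebra R S)
      (ℬ : ℚ → AddSubgroup S) (_ : GradedRing ℬ),
      Module.Finite R S ∧
      Function.Injective (algebraMap R S) ∧
      (∀ (i : ℕ), ∀ r ∈ 𝒜 i, algebraMap R S r ∈ ℬ (i : ℚ)) ∧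
      ∀ (n : ℕ) (x : Fin n → R), GradedLC.Supports 𝒜 x →
        ∀ η ∈ GradedLC.localCohNonneg 𝒜 x d,
          GradedLC.localCohMap x (Algebra.linearMap R S) d η = 0 := by
  classical
  have hp : 1 < p := (Fact.out : p.Prime).one_lt
  have hchar : CharP (GradedLC.Host 𝒜) p := charP_of_injective_algebraMap
    (algebraMap K (GradedLC.Host 𝒜)).injective p
  have hexp : ExpChar (GradedLC.Host 𝒜) p := inferInstance
  have hH := GradedLC.Host.isHost (𝒜 := 𝒜) h0 hp
  obtain ⟨t, δ, ht, hrad⟩ := GradedLC.exists_homogeneous_parameters h0 hd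
  obtain ⟨E, hE, hEtop⟩ := GradedLC.exists_monomialSpan_eq_top h0 (fun i => (ht i).2.1)
    (fun i => (ht i).1) hrad
  obtain ⟨H, hHint, hHS⟩ := GradedLC.exists_finset_forall_mem_faceSum h0 hp hH hpos ht hE hEtop
  let S : Subalgebra R (GradedLC.Host 𝒜) := Algebra.adjoin R (H : Set (GradedLC.Host 𝒜))
  have hkill : ∀ (n : ℕ) (x : Fin n → R), GradedLC.Supports 𝒜 x → ∀ (m : ℕ)
      (c : GradedLC.Cochain x R d), c ∈ GradedLC.cocycles x R d →
      (∀ τ, c τ ∈ GradedLC.locDegree 𝒜 (GradedLC.prodAt x τ) m) →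
      GradedLC.cochainMap x (Algebra.linearMap R S) d c ∈ GradedLC.coboundaries x S d :=
    fun n x hx m c hc hcdeg => GradedLC.cochainMap_mem_coboundaries
      hH.algebraMap_mem hH.isUnit_algebraMap hpos ht hrad
      (hHS S Algebra.subset_adjoin) hx hc hcdeg
  refine ⟨fun n x hx => ?_, S, inferInstance, inferInstance, inferInstance,
    GradedLC.gradedPart (GradedLC.Host.grade 𝒜) S,
    GradedLC.gradedRingGradedPart _ (GradedLC.decompose_mem_adjoin
      (fun h hh => (hHint h hh).2.imp fun _ h => h.2)
      (fun r => GradedLC.decompose_mem_bot hH.algebraMap_mem _ (Algebra.mem_bot.2 ⟨r, rfl⟩))),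
    ?_, ?_, ?_, fun n x hx => ?_⟩
  · refine GradedLC.localCohMap_eq_zero_of_mem_localCohNonneg _ fun m c hc hcdeg => ?_
    -- Setting u = 1 sends each generator of S to an element with an assigned degree, so R → R^{+GR}
    -- factors through S and coboundaries over S map to coboundaries.
    have hle : S ≤ (GradedLC.PlusGR 𝒜).comap (GradedLC.Host.evalAlgHom 𝒜) := by
      refine Algebra.adjoin_le fun h hh => ?_
      obtain ⟨hint, q, hq, hhq⟩ := hHint h hh
      exact Algebra.subset_adjoin ⟨q, hq, GradedLC.Host.hasDegree_eval hint hhq⟩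
    let g : S →ₐ[R] GradedLC.PlusGR 𝒜 :=
      ((GradedLC.Host.evalAlgHom 𝒜).comp S.val).codRestrict _ fun s => hle s.2
    have hg : Algebra.linearMap R (GradedLC.PlusGR 𝒜) =
        g.toLinearMap ∘ₗ Algebra.linearMap R S := by
      ext
      simp
    rw [hg, GradedLC.cochainMap_comp]
    exact GradedLC.cochainMap_coboundaries x _ d _ (hkill n x hx m c hc hcdeg)
  · exact ⟨(Submodule.fg_top _).2 (fg_adjoin_of_finite H.finite_toSet
      fun h hh => (hHint h hh).1)⟩
  · intro a b hab
    exact GradedLC.Host.algebraMap_injective (congrArg Subtype.val hab)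
  · exact fun i r hr => hH.algebraMap_mem i r hr
  · exact GradedLC.localCohMap_eq_zero_of_mem_localCohNonneg _ (hkill n x hx)
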